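/- Let $G$ be a second countable locally compact Hausdorff groupoid with unit space $G^0$, range and source maps $r,s:G\to G^0$, and a left Haar system $\{\lambda^u\}_{u\in G^0}$, where $\lambda^u$ is supported on $G^u=r^{-1}(\{u\})$. Inner products are conjugate linear in the first variable. A $G$-Hilbert bundle is a continuous field $\{\mathfrak H^u\}_{u\in G^0}$ of separable Hilbert spaces over $G^0$ together with a surjective linear isometry $L_x:\mathfrak H^{s(x)}\to\mathfrak H^{r(x)}$ for each $x\in G$, such that $L_{xy}=L_xL_y$ whenever $s(x)=r(y)$, and such that for all bounded continuous sections $\xi,\eta$ the coefficient $(\xi,\eta):G\to\mathbb C$, $(\xi,\eta)(x)=\langle L_x\xi(s(x)),\eta(r(x))\rangle$, is continuous. Let $B(G)$ be the set of all coefficients $(\xi,\eta)$ of bounded continuous sections of $G$-Hilbert bundles, with the norm $\|\phi\|=\inf\|\xi\|\,\|\eta\|$, the infimum being over all representations $\phi=(\xi,\eta)$ of this kind, where $\|\xi\|=\sup_u\|\xi(u)\|$. For $f,g\in C_c(G)$ put $$(f,g)(x)=\int \overline{f(x^{-1}t)}\,g(t)\,d\lambda^{r(x)}(t),$$ let $A_c(G)$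 be the algebra generated under pointwise operations by the functions $(f,g)$ with $f,g\in C_c(G)$, and let the Fourier algebra $A(G)$ be the closure of $A_c(G)$ in $B(G)$ for the norm $\|\cdot\|$. If $G$ is $r$-discrete, that is, if $G^0$ is open in $G$, then $A(G)$ is an ideal in $B(G)$: the set $B(G)$ is a unital subalgebra of the algebra of all functions $G\to\mathbb C$ with pointwise operations, and $A(G)$ is an ideal of this algebra. -/

import Mathlib

open MeasureTheory Set Filter Topology
open scoped CompactlySupported InnerProductSpace

universe u

/-- A topological groupoid with space of arrows `G` and unit space `X`, the latter embedded in `G`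
by `unit`; `r` and `s` are the range and source maps. The product `mul x y` is meaningful only for
composable pairs, that is when `s x = r y`: all laws, and the continuity of the product, concern
composable pairs only, and the other values of `mul` play no role. -/
structure TopGroupoid (G X : Type u) [TopologicalSpace G] [TopologicalSpace X] where
  r : G → X
  s : G → X
  unit : X → G
  mul : G → G → G
  inv : G → G
  r_unit : ∀ a, r (unit a) = a
  s_unit : ∀ a, s (unit a) = a
  r_mul : ∀ x y, s x = r y → r (mul x y) = r x
  s_mul : ∀ x y, s x = r y → s (mul x y) = s y
  mul_assoc : ∀ x y z, s x = r y → s y = r z → mul (mul x y) z = mul x (mul y z)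
  unit_mul : ∀ x, mul (unit (r x)) x = x
  mul_unit : ∀ x, mul x (unit (s x)) = x
  r_inv : ∀ x, r (inv x) = s x
  s_inv : ∀ x, s (inv x) = r x
  inv_mul : ∀ x, mul (inv x) x = unit (s x)
  mul_inv : ∀ x, mul x (inv x) = unit (r x)
  continuous_r : Continuous r
  continuous_s : Continuous s
  continuous_unit : Continuous unit
  continuous_inv : Continuous inv
  continuousOn_mul : ContinuousOn (fun p : G × G => mul p.1 p.2) {p | s p.1 = r p.2}

/-- A continuous field of Hilbert spaces (a continuous Hilbert bundle) over `X`, with separable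
fibres: a linear space `sections` of sections (the continuous sections), which fills up a dense
subspace of each fibre, whose members have continuous norm functions, and which contains every
section that can be approximated locally uniformly by its members. -/
structure HilbertBundle (X : Type u) [TopologicalSpace X] where
  fiber : X → Type u
  [normedAddCommGroup : ∀ a, NormedAddCommGroup (fiber a)]
  [innerProductSpace : ∀ a, InnerProductSpace ℂ (fiber a)]
  [completeSpace : ∀ a, CompleteSpace (fiber a)]
  [separableSpace : ∀ a, TopologicalSpace.SeparableSpace (fiber a)]
  sections : Submodule ℂ (∀ a, fiber a)
  dense_sections : ∀ a, Dense {v : fiber a | ∃ ξ ∈ sections, ξ a = v}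
  continuous_norm : ∀ ξ ∈ sections, Continuous fun a => ‖ξ a‖
  mem_of_locally_approx : ∀ ξ : ∀ a, fiber a,
    (∀ a, ∀ ε : ℝ, 0 < ε → ∃ ξ' ∈ sections, ∀ᶠ b in 𝓝 a, ‖ξ b - ξ' b‖ ≤ ε) → ξ ∈ sections

attribute [instance] HilbertBundle.normedAddCommGroup HilbertBundle.innerProductSpace
  HilbertBundle.completeSpace HilbertBundle.separableSpace

namespace HilbertBundle

/-- The space `Δ_b` of bounded continuous sections. -/
def boundedSections {X : Type u} [TopologicalSpace X] (H : HilbertBundle X) :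
    Set (∀ a, H.fiber a) :=
  {ξ | ξ ∈ H.sections ∧ BddAbove (range fun a => ‖ξ a‖)}

/-- The norm `sup_a ‖ξ a‖` of a bounded section. -/
noncomputable def sectionNorm {X : Type u} [TopologicalSpace X] (H : HilbertBundle X)
    (ξ : ∀ a, H.fiber a) : ℝ :=
  ⨆ a, ‖ξ a‖

end HilbertBundle

/-- A `G`-Hilbert bundle: a continuous Hilbert bundle over the unit space, with a surjective linear
isometry `L_x` from the fibre at `s x` to the fibre at `r x` for every arrow `x`, such that
`x ↦ L_x` is a homomorphism of groupoids and all coefficients of bounded continuous sections are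
continuous. The isometry `L_x` is `act x rfl rfl`; it is given as a map between the fibres at any
`a`, `b` with `s x = a` and `r x = b` so that `L_{xy} = L_x L_y` can be stated without casts. -/
structure GHilbertBundle {G X : Type u} [TopologicalSpace G] [TopologicalSpace X]
    (𝒢 : TopGroupoid G X) extends HilbertBundle X where
  act : ∀ (x : G) {a b : X}, 𝒢.s x = a → 𝒢.r x = b → (fiber a ≃ₗᵢ[ℂ] fiber b)
  act_mul : ∀ (x y : G) {a b c : X} (hya : 𝒢.s y = a) (hyb : 𝒢.r y = b) (hxb : 𝒢.s x = b)
    (hxc : 𝒢.r x = c) (hsa : 𝒢.s (𝒢.mul x y) = a) (hrc : 𝒢.r (𝒢.mul x y) = c) (v : fiber a),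
    act (𝒢.mul x y) hsa hrc v = act x hxb hxc (act y hya hyb v)
  continuous_coeff : ∀ ξ ∈ toHilbertBundle.boundedSections,
    ∀ η ∈ toHilbertBundle.boundedSections,
      Continuous fun x : G => ⟪act x rfl rfl (ξ (𝒢.s x)), η (𝒢.r x)⟫_ℂ

namespace TopGroupoid

/-- A groupoid is `r`-discrete if its unit space is open in it. -/
def IsRDiscrete {G X : Type u} [TopologicalSpace G] [TopologicalSpace X]
    (𝒢 : TopGroupoid G X) : Prop :=
  IsOpen (range 𝒢.unit)

/-- A left Haar system: measures `λ^a` on `G`, finite on compact sets, with support exactly the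
fibre `r⁻¹{a}`, which vary continuously and are invariant under left translation. -/
structure IsHaarSystem {G X : Type u} [TopologicalSpace G] [TopologicalSpace X]
    [MeasurableSpace G] (𝒢 : TopGroupoid G X) (lam : X → Measure G) : Prop where
  finite_on_compacts : ∀ a, IsFiniteMeasureOnCompacts (lam a)
  support_eq : ∀ a, (lam a).support = 𝒢.r ⁻¹' {a}
  continuous_integral : ∀ f : C_c(G, ℂ), Continuous fun a => ∫ y, f y ∂lam a
  left_invariant : ∀ (x : G) (f : C_c(G, ℂ)),
    ∫ y, f (𝒢.mul x y) ∂lam (𝒢.s x) = ∫ y, f y ∂lam (𝒢.r x)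

/-- The coefficient `(ξ, η)(x) = (L_x ξ(s x), η(r x))` of a `G`-Hilbert bundle; inner products are
conjugate linear in the first variable. -/
noncomputable def coeff {G X : Type u} [TopologicalSpace G] [TopologicalSpace X]
    {𝒢 : TopGroupoid G X} (H : GHilbertBundle 𝒢) (ξ η : ∀ a, H.fiber a) : G → ℂ :=
  fun x => ⟪H.act x rfl rfl (ξ (𝒢.s x)), η (𝒢.r x)⟫_ℂ

/-- The Fourier-Stieltjes algebra `B(G)`: all coefficients of bounded continuous sections of
`G`-Hilbert bundles. -/
def fourierStieltjes {G X : Type u} [TopologicalSpace G] [TopologicalSpace X]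
    (𝒢 : TopGroupoid G X) : Set (G → ℂ) :=
  {φ | ∃ H : GHilbertBundle 𝒢, ∃ ξ ∈ H.boundedSections, ∃ η ∈ H.boundedSections, φ = coeff H ξ η}

/-- The norm of `B(G)`: the infimum of `‖ξ‖ ‖η‖` over all representations `φ = (ξ, η)`. -/
noncomputable def fsNorm {G X : Type u} [TopologicalSpace G] [TopologicalSpace X]
    (𝒢 : TopGroupoid G X) (φ : G → ℂ) : ℝ :=
  sInf {c | ∃ H : GHilbertBundle 𝒢, ∃ ξ ∈ H.boundedSections, ∃ η ∈ H.boundedSections,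
    φ = coeff H ξ η ∧ c = H.sectionNorm ξ * H.sectionNorm η}

/-- The coefficient `(f, g)` of the left regular bundle `{L²(r⁻¹{a}, λ^a)}`, on which `G` acts by
`(L_x ξ)(t) = ξ(x⁻¹ t)`, for `f, g ∈ C_c(G)`. -/
noncomputable def regularCoeff {G X : Type u} [TopologicalSpace G] [TopologicalSpace X]
    [MeasurableSpace G] (𝒢 : TopGroupoid G X) (lam : X → Measure G) (f g : C_c(G, ℂ)) : G → ℂ :=
  fun x => ∫ t, ⟪f (𝒢.mul (𝒢.inv x) t), g t⟫_ℂ ∂lam (𝒢.r x)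

/-- `A_c(G)`: the (not necessarily unital) subalgebra, for the pointwise operations, generated by
the coefficients `(f, g)` with `f, g ∈ C_c(G)` of the left regular bundle. -/
noncomputable def regularAlgebra {G X : Type u} [TopologicalSpace G] [TopologicalSpace X]
    [MeasurableSpace G] (𝒢 : TopGroupoid G X) (lam : X → Measure G) :
    NonUnitalSubalgebra ℂ (G → ℂ) :=
  NonUnitalAlgebra.adjoin ℂ {φ | ∃ f g : C_c(G, ℂ), φ = regularCoeff 𝒢 lam f g}

/-- The Fourier algebra `A(G)`: the closure of `A_c(G)` in `B(G)`. -/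
def fourierAlgebra {G X : Type u} [TopologicalSpace G] [TopologicalSpace X]
    [MeasurableSpace G] (𝒢 : TopGroupoid G X) (lam : X → Measure G) : Set (G → ℂ) :=
  {φ | φ ∈ fourierStieltjes 𝒢 ∧ ∀ ε : ℝ, 0 < ε → ∃ ψ ∈ regularAlgebra 𝒢 lam,
    φ - ψ ∈ fourierStieltjes 𝒢 ∧ fsNorm 𝒢 (φ - ψ) < ε}

end TopGroupoid

/-! `B(G)` is a unital algebra because direct sums of bundles add coefficients, completed tensor
products multiply them, and the trivial line bundle gives `1`.

The ideal property is Fell's absorption principle. When `G` is `r`-discrete, the map `r` is a local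
homeomorphism and each `λ^a` is atomic; the mass of `{t}` is a positive continuous function of `s
t`, so it can be absorbed into `g` and the regular coefficients become coefficients for counting
measure (`regularCoeff_eq`). For a `G`-Hilbert bundle `H`, let `G` act on the spaces `ℓ²(r⁻¹{a},
H_a)` by `(U_x v)(t) = L_x v(x⁻¹t)`. The sections `t ↦ f(t) L_t ζ(s t)` have coefficients in
`A_c(G)`, since `L_t` cancels in the inner product (`inner_inducedAct_translatedSection`). The
sections `t ↦ f(t) ξ(r t)` have coefficients `(ξ, η) · (f, g)` (`inner_inducedAct_rangeSection`). A
partition of unity on the support of `f` shows that sections of the second kind are uniform limits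
of combinations of the first (`exists_translatedSection_approx`). Hence `(ξ, η) · (f, g)` lies in
`A(G)`; induction over `A_c(G)` and closedness of `A(G)` extend this to all products. -/

namespace HilbertBundle

/-! ### Continuous sections of Hilbert bundles -/

variable {X : Type u} [TopologicalSpace X] (H : HilbertBundle X)

theorem smul_mem_sections {h : X → ℂ} (hh : Continuous h) {ξ : ∀ a, H.fiber a}
    (hξ : ξ ∈ H.sections) : (fun a => h a • ξ a) ∈ H.sections := by
  refine H.mem_of_locally_approx _ fun a ε hε =>
    ⟨h a • ξ, H.sections.smul_mem _ hξ, ?_⟩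
  have hc : Continuous fun b => ‖h b - h a‖ * ‖ξ b‖ :=
    (hh.sub continuous_const).norm.mul (H.continuous_norm ξ hξ)
  have : ∀ᶠ b in 𝓝 a, ‖h b - h a‖ * ‖ξ b‖ < ε :=
    hc.continuousAt.eventually_lt continuousAt_const (by simpa using hε)
  filter_upwards [this] with b hb
  rw [Pi.smul_apply, ← sub_smul, norm_smul]
  exact hb.le

theorem continuous_inner {ξ η : ∀ a, H.fiber a} (hξ : ξ ∈ H.sections) (hη : η ∈ H.sections) :
    Continuous fun a => ⟪ξ a, η a⟫_ℂ := by
  have h1 := H.continuous_norm _ (H.sections.add_mem hξ hη)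
  have h2 := H.continuous_norm _ (H.sections.sub_mem hξ hη)
  have h3 := H.continuous_norm _ (H.sections.sub_mem hξ (H.sections.smul_mem Complex.I hη))
  have h4 := H.continuous_norm _ (H.sections.add_mem hξ (H.sections.smul_mem Complex.I hη))
  simp only [Pi.add_apply, Pi.sub_apply, Pi.smul_apply] at h1 h2 h3 h4
  simp_rw [inner_eq_sum_norm_sq_div_four]
  simp only [RCLike.I_to_complex, Complex.coe_algebraMap]
  fun_prop

theorem exists_boundedSections_eq {ξ : ∀ a, H.fiber a} (hξ : ξ ∈ H.sections) (a : X) :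
    ∃ ζ ∈ H.boundedSections, ζ a = ξ a := by
  have hn := H.continuous_norm ξ hξ
  have hpos : ∀ b, (0 : ℝ) < 1 + ‖ξ b‖ := fun b => by positivity
  -- The factor is continuous, equals `1` at `b = a`, and keeps the norm below `1 + ‖ξ a‖`.
  refine ⟨fun b => (((1 + ‖ξ a‖) / (1 + ‖ξ b‖) : ℝ) : ℂ) • ξ b, ⟨H.smul_mem_sections ?_ hξ, ?_⟩, ?_⟩
  · exact Complex.continuous_ofReal.comp
      (continuous_const.div (continuous_const.add hn) fun b => (hpos b).ne')
  · refine ⟨1 + ‖ξ a‖, ?_⟩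
    rintro _ ⟨b, rfl⟩
    simp only [norm_smul, Complex.norm_real, Real.norm_eq_abs]
    rw [abs_of_pos (div_pos (hpos a) (hpos b)), div_mul_eq_mul_div, div_le_iff₀ (hpos b)]
    exact mul_le_mul_of_nonneg_left (by linarith) (hpos a).le
  · simp [div_self (hpos a).ne']

theorem dense_boundedSections (a : X) : Dense {v : H.fiber a | ∃ ξ ∈ H.boundedSections, ξ a = v} := by
  refine (H.dense_sections a).mono ?_
  rintro _ ⟨ξ, hξ, rfl⟩
  exact H.exists_boundedSections_eq hξ a

variable {H}

theorem exists_bound_of_mem {ξ : ∀ a, H.fiber a} (hξ : ξ ∈ H.boundedSections) :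
    ∃ C : ℝ, 0 < C ∧ ∀ a, ‖ξ a‖ ≤ C := by
  obtain ⟨C, hC⟩ := hξ.2
  exact ⟨max C 1, by positivity, fun a => (hC ⟨a, rfl⟩).trans (le_max_left _ _)⟩

theorem mem_boundedSections_of_le {ξ : ∀ a, H.fiber a} (hξ : ξ ∈ H.sections) {C : ℝ}
    (hC : ∀ a, ‖ξ a‖ ≤ C) : ξ ∈ H.boundedSections :=
  ⟨hξ, C, by rintro _ ⟨a, rfl⟩; exact hC a⟩

theorem smul_mem_boundedSections (c : ℂ) {ξ : ∀ a, H.fiber a} (hξ : ξ ∈ H.boundedSections) :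
    c • ξ ∈ H.boundedSections := by
  obtain ⟨C, _, hC⟩ := exists_bound_of_mem hξ
  refine mem_boundedSections_of_le (H.sections.smul_mem c hξ.1) (C := ‖c‖ * C) fun a => ?_
  rw [Pi.smul_apply, norm_smul]
  exact mul_le_mul_of_nonneg_left (hC a) (norm_nonneg c)

end HilbertBundle

/-! ### Bundles presented by generating sections -/

section Generators

variable {X : Type u} [TopologicalSpace X] {fiber : X → Type u} [∀ a, NormedAddCommGroup (fiber a)]
  [∀ a, InnerProductSpace ℂ (fiber a)]

/-- The sections which are locally uniform limits of members of `Γ`. -/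
def locallyApproximable (Γ : Submodule ℂ (∀ a, fiber a)) : Submodule ℂ (∀ a, fiber a) where
  carrier := {ξ | ∀ a, ∀ ε : ℝ, 0 < ε → ∃ ξ' ∈ Γ, ∀ᶠ b in 𝓝 a, ‖ξ b - ξ' b‖ ≤ ε}
  zero_mem' := fun a ε hε => ⟨0, Γ.zero_mem, by simp [hε.le]⟩
  add_mem' := by
    intro ξ η hξ hη a ε hε
    obtain ⟨ξ', h1, h1'⟩ := hξ a (ε / 2) (half_pos hε)
    obtain ⟨η', h2, h2'⟩ := hη a (ε / 2) (half_pos hε)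
    refine ⟨ξ' + η', Γ.add_mem h1 h2, ?_⟩
    filter_upwards [h1', h2'] with b hb hb'
    rw [Pi.add_apply, Pi.add_apply, add_sub_add_comm]
    exact (norm_add_le _ _).trans (by linarith)
  smul_mem' := by
    intro c ξ hξ a ε hε
    obtain ⟨ξ', h1, h1'⟩ := hξ a (ε / (‖c‖ + 1)) (by positivity)
    refine ⟨c • ξ', Γ.smul_mem c h1, ?_⟩
    filter_upwards [h1'] with b hb
    rw [Pi.smul_apply, Pi.smul_apply, ← smul_sub, norm_smul]
    rw [le_div_iff₀ (by positivity)] at hb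
    nlinarith [norm_nonneg (ξ b - ξ' b)]

theorem le_locallyApproximable (Γ : Submodule ℂ (∀ a, fiber a)) : Γ ≤ locallyApproximable Γ :=
  fun ξ hξ _ ε hε => ⟨ξ, hξ, by simp [hε.le]⟩

theorem mem_locallyApproximable_of_approx (Γ : Submodule ℂ (∀ a, fiber a)) (ξ : ∀ a, fiber a)
    (h : ∀ a, ∀ ε : ℝ, 0 < ε → ∃ ξ' ∈ locallyApproximable Γ, ∀ᶠ b in 𝓝 a, ‖ξ b - ξ' b‖ ≤ ε) :
    ξ ∈ locallyApproximable Γ := by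
  intro a ε hε
  obtain ⟨ξ', h1, h1'⟩ := h a (ε / 2) (half_pos hε)
  obtain ⟨ξ'', h2, h2'⟩ := h1 a (ε / 2) (half_pos hε)
  refine ⟨ξ'', h2, ?_⟩
  filter_upwards [h1', h2'] with b hb hb'
  calc ‖ξ b - ξ'' b‖ = ‖(ξ b - ξ' b) + (ξ' b - ξ'' b)‖ := by rw [sub_add_sub_cancel]
    _ ≤ _ := norm_add_le _ _
    _ ≤ ε := by linarith

/-- A function that can be approximated near each point by continuous functions is continuous. -/
theorem continuous_of_locally_approx {Y : Type*} [TopologicalSpace Y] {φ : Y → ℂ}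
    (h : ∀ y, ∀ ε : ℝ, 0 < ε → ∃ ψ : Y → ℂ, Continuous ψ ∧ ∀ᶠ z in 𝓝 y, ‖φ z - ψ z‖ ≤ ε) :
    Continuous φ := by
  refine continuous_of_locally_uniform_approx_of_continuousAt fun y u hu => ?_
  obtain ⟨ε, hε, hεu⟩ := Metric.mem_uniformity_dist.1 hu
  obtain ⟨ψ, hψ, he⟩ := h y (ε / 2) (half_pos hε)
  refine ⟨_, he, ψ, hψ.continuousAt, fun z hz => hεu ?_⟩
  rw [dist_eq_norm]
  exact lt_of_le_of_lt hz (half_lt_self hε)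

variable {G : Type u} [TopologicalSpace G] {𝒢 : TopGroupoid G X}

theorem act_congr (act : ∀ (x : G) {a b : X}, 𝒢.s x = a → 𝒢.r x = b → (fiber a ≃ₗᵢ[ℂ] fiber b))
    {x x' : G} (h : x = x') {a b : X} (ha : 𝒢.s x = a) (hb : 𝒢.r x = b) (v : fiber a) :
    act x ha hb v = act x' (h ▸ ha) (h ▸ hb) v := by
  subst h; rfl

/-- A unit is idempotent, so `L_e L_e = L_e`, and `L_e` is injective. -/
theorem act_unit (act : ∀ (x : G) {a b : X}, 𝒢.s x = a → 𝒢.r x = b → (fiber a ≃ₗᵢ[ℂ] fiber b))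
    (act_mul : ∀ (x y : G) {a b c : X} (hya : 𝒢.s y = a) (hyb : 𝒢.r y = b) (hxb : 𝒢.s x = b)
      (hxc : 𝒢.r x = c) (hsa : 𝒢.s (𝒢.mul x y) = a) (hrc : 𝒢.r (𝒢.mul x y) = c) (v : fiber a),
      act (𝒢.mul x y) hsa hrc v = act x hxb hxc (act y hya hyb v))
    (a : X) (v : fiber a) : act (𝒢.unit a) (𝒢.s_unit a) (𝒢.r_unit a) v = v := by
  have hm : 𝒢.mul (𝒢.unit a) (𝒢.unit a) = 𝒢.unit a := by
    have := 𝒢.unit_mul (𝒢.unit a)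
    rwa [𝒢.r_unit] at this
  have h := act_mul (𝒢.unit a) (𝒢.unit a) (𝒢.s_unit a) (𝒢.r_unit a) (𝒢.s_unit a) (𝒢.r_unit a)
    (by rw [hm, 𝒢.s_unit]) (by rw [hm, 𝒢.r_unit]) v
  rw [act_congr act hm] at h
  exact ((act (𝒢.unit a) (𝒢.s_unit a) (𝒢.r_unit a)).injective h).symm

theorem continuous_coeff_of_mem_span
    (act : ∀ (x : G) {a b : X}, 𝒢.s x = a → 𝒢.r x = b → (fiber a ≃ₗᵢ[ℂ] fiber b))
    (S : Set (∀ a, fiber a))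
    (cont : ∀ ξ ∈ S, ∀ η ∈ S,
      Continuous fun x : G => ⟪act x rfl rfl (ξ (𝒢.s x)), η (𝒢.r x)⟫_ℂ)
    {ξ η : ∀ a, fiber a} (hξ : ξ ∈ Submodule.span ℂ S) (hη : η ∈ Submodule.span ℂ S) :
    Continuous fun x : G => ⟪act x rfl rfl (ξ (𝒢.s x)), η (𝒢.r x)⟫_ℂ := by
  induction hξ, hη using Submodule.span_induction₂ with
  | mem_mem ξ η hξ hη => exact cont ξ hξ η hη
  | zero_left => simp [continuous_const]
  | zero_right => simp [continuous_const]
  | add_left _ _ _ _ _ _ h1 h2 => simpa [inner_add_left] using h1.fun_add h2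
  | add_right _ _ _ _ _ _ h1 h2 => simpa [inner_add_right] using h1.fun_add h2
  | smul_left c _ _ _ _ h => simpa [inner_smul_left] using h.mul_const _
  | smul_right c _ _ _ _ h => simpa [inner_smul_right] using h.const_mul _

/-- Restricted to the units, the coefficient `(ξ, ξ)` is `‖ξ‖²`. Continuity of norms therefore never
has to be required of generators. -/
theorem continuous_norm_of_continuous_coeff
    (act : ∀ (x : G) {a b : X}, 𝒢.s x = a → 𝒢.r x = b → (fiber a ≃ₗᵢ[ℂ] fiber b))
    (act_mul : ∀ (x y : G) {a b c : X} (hya : 𝒢.s y = a) (hyb : 𝒢.r y = b) (hxb : 𝒢.s x = b)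
      (hxc : 𝒢.r x = c) (hsa : 𝒢.s (𝒢.mul x y) = a) (hrc : 𝒢.r (𝒢.mul x y) = c) (v : fiber a),
      act (𝒢.mul x y) hsa hrc v = act x hxb hxc (act y hya hyb v))
    (ξ : ∀ a, fiber a) (h : Continuous fun x : G => ⟪act x rfl rfl (ξ (𝒢.s x)), ξ (𝒢.r x)⟫_ℂ) :
    Continuous fun a => ‖ξ a‖ := by
  have h2 := h.comp 𝒢.continuous_unit
  -- The points `s (unit a)` and `r (unit a)` equal `a` only propositionally; with a free arrow `x`
  -- the equalities can be substituted.
  have key : ∀ (x : G) (a : X) (hs : 𝒢.s x = a) (hr : 𝒢.r x = a),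
      ⟪act x rfl rfl (ξ (𝒢.s x)), ξ (𝒢.r x)⟫_ℂ = ⟪act x hs hr (ξ a), ξ a⟫_ℂ := by
    intro x a hs hr
    subst hs
    have : ∀ (b : X) (hb : 𝒢.r x = b), ⟪act x rfl rfl (ξ (𝒢.s x)), ξ (𝒢.r x)⟫_ℂ =
      ⟪act x rfl hb (ξ (𝒢.s x)), ξ b⟫_ℂ := by
      rintro b rfl; rfl
    exact this _ hr
  have h3 : ((fun x : G => ⟪act x rfl rfl (ξ (𝒢.s x)), ξ (𝒢.r x)⟫_ℂ) ∘ 𝒢.unit) =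
      fun a => ((‖ξ a‖ : ℂ)) ^ 2 := by
    funext a
    rw [Function.comp_apply, key (𝒢.unit a) a (𝒢.s_unit a) (𝒢.r_unit a), act_unit act act_mul]
    exact inner_self_eq_norm_sq_to_K _
  rw [h3] at h2
  have h4 := (Complex.continuous_re.comp h2).sqrt
  refine h4.congr fun a => ?_
  rw [Function.comp_apply, ← Complex.ofReal_pow, Complex.ofReal_re, Real.sqrt_sq (norm_nonneg _)]

theorem norm_inner_sub_inner_le {E : Type*} [NormedAddCommGroup E] [InnerProductSpace ℂ E]
    (v w v' w' : E) :
    ‖⟪v, w⟫_ℂ - ⟪v', w'⟫_ℂ‖ ≤ (‖v'‖ + ‖v - v'‖) * ‖w - w'‖ + ‖v - v'‖ * ‖w'‖ := by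
  have : ⟪v, w⟫_ℂ - ⟪v', w'⟫_ℂ = ⟪v, w - w'⟫_ℂ + ⟪v - v', w'⟫_ℂ := by
    rw [inner_sub_right, inner_sub_left]; ring
  rw [this]
  refine (norm_add_le _ _).trans (add_le_add ((norm_inner_le_norm _ _).trans ?_)
    (norm_inner_le_norm _ _))
  refine mul_le_mul_of_nonneg_right ?_ (norm_nonneg _)
  calc ‖v‖ = ‖v' + (v - v')‖ := by rw [add_sub_cancel]
    _ ≤ _ := norm_add_le _ _

theorem continuous_coeff_of_mem_locallyApproximable
    (act : ∀ (x : G) {a b : X}, 𝒢.s x = a → 𝒢.r x = b → (fiber a ≃ₗᵢ[ℂ] fiber b))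
    (Γ : Submodule ℂ (∀ a, fiber a))
    (norm_cont : ∀ ξ ∈ Γ, Continuous fun a => ‖ξ a‖)
    (cont : ∀ ξ ∈ Γ, ∀ η ∈ Γ,
      Continuous fun x : G => ⟪act x rfl rfl (ξ (𝒢.s x)), η (𝒢.r x)⟫_ℂ)
    {ξ η : ∀ a, fiber a} (hξ : ξ ∈ locallyApproximable Γ) (hη : η ∈ locallyApproximable Γ) :
    Continuous fun x : G => ⟪act x rfl rfl (ξ (𝒢.s x)), η (𝒢.r x)⟫_ℂ := by
  refine continuous_of_locally_approx fun x ε hε => ?_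
  -- The error for `η` must be small relative to `ξ'`, and that for `ξ` relative to `η'`. The crude
  -- approximant `ξ₁` breaks the circle: it bounds every later `ξ'` near `s x`, so `δ`, `η'`, `κ`,
  -- `ξ'` can be chosen in this order.
  obtain ⟨ξ₁, hξ₁, hξ₁'⟩ := hξ (𝒢.s x) 1 one_pos
  obtain ⟨δ, hδ, hδ1, hδε⟩ : ∃ δ : ℝ, 0 < δ ∧ δ ≤ 1 ∧ (‖ξ₁ (𝒢.s x)‖ + 5) * δ ≤ ε / 2 := by
    refine ⟨min 1 (ε / 2 / (‖ξ₁ (𝒢.s x)‖ + 5)), by positivity, min_le_left _ _, ?_⟩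
    rw [mul_comm, ← le_div_iff₀ (by positivity)]
    exact min_le_right _ _
  obtain ⟨η', hη', hη''⟩ := hη (𝒢.r x) δ hδ
  obtain ⟨κ, hκ, hκ1, hκε⟩ : ∃ κ : ℝ, 0 < κ ∧ κ ≤ 1 ∧ κ * (‖η' (𝒢.r x)‖ + 1) ≤ ε / 2 := by
    refine ⟨min 1 (ε / 2 / (‖η' (𝒢.r x)‖ + 1)), by positivity, min_le_left _ _, ?_⟩
    rw [← le_div_iff₀ (by positivity)]
    exact min_le_right _ _
  obtain ⟨ξ', hξ', hξ''⟩ := hξ (𝒢.s x) κ hκ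
  refine ⟨_, cont ξ' hξ' η' hη', ?_⟩
  have e1 : ∀ᶠ a in 𝓝 (𝒢.s x), ‖ξ₁ a‖ < ‖ξ₁ (𝒢.s x)‖ + 1 :=
    (norm_cont _ hξ₁).continuousAt.eventually_lt continuousAt_const (by linarith)
  have e2 : ∀ᶠ a in 𝓝 (𝒢.r x), ‖η' a‖ < ‖η' (𝒢.r x)‖ + 1 :=
    (norm_cont _ hη').continuousAt.eventually_lt continuousAt_const (by linarith)
  have hs := 𝒢.continuous_s.continuousAt (x := x)
  have hr := 𝒢.continuous_r.continuousAt (x := x)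
  filter_upwards [hs.eventually hξ₁', hs.eventually hξ'', hr.eventually hη'', hs.eventually e1,
    hr.eventually e2] with z h1 h2 h3 h4 h5
  refine (norm_inner_sub_inner_le _ _ _ _).trans ?_
  rw [← map_sub, LinearIsometryEquiv.norm_map, LinearIsometryEquiv.norm_map]
  have h6 : ‖ξ' (𝒢.s z)‖ ≤ ‖ξ₁ (𝒢.s x)‖ + 3 := by
    have := norm_sub_norm_le (ξ' (𝒢.s z)) (ξ₁ (𝒢.s z))
    have h7 : ‖ξ' (𝒢.s z) - ξ₁ (𝒢.s z)‖ ≤ 2 := by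
      calc _ = ‖(ξ (𝒢.s z) - ξ₁ (𝒢.s z)) - (ξ (𝒢.s z) - ξ' (𝒢.s z))‖ := by
            rw [sub_sub_sub_cancel_left]
        _ ≤ _ := norm_sub_le _ _
        _ ≤ 2 := by linarith
    linarith
  have a1 : (‖ξ' (𝒢.s z)‖ + ‖ξ (𝒢.s z) - ξ' (𝒢.s z)‖) * ‖η (𝒢.r z) - η' (𝒢.r z)‖ ≤
      (‖ξ₁ (𝒢.s x)‖ + 5) * δ :=
    mul_le_mul (by linarith) h3 (norm_nonneg _) (by positivity)
  have a2 : ‖ξ (𝒢.s z) - ξ' (𝒢.s z)‖ * ‖η' (𝒢.r z)‖ ≤ κ * (‖η' (𝒢.r x)‖ + 1) :=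
    mul_le_mul h2 h5.le (norm_nonneg _) hκ.le
  linarith

/-- The `G`-Hilbert bundle whose continuous sections are generated by a set `S` of sections which
spans a dense subspace of each fibre and all of whose coefficients are continuous. -/
def GHilbertBundle.ofGenerators [∀ a, CompleteSpace (fiber a)]
    [∀ a, TopologicalSpace.SeparableSpace (fiber a)]
    (act : ∀ (x : G) {a b : X}, 𝒢.s x = a → 𝒢.r x = b → (fiber a ≃ₗᵢ[ℂ] fiber b))
    (act_mul : ∀ (x y : G) {a b c : X} (hya : 𝒢.s y = a) (hyb : 𝒢.r y = b) (hxb : 𝒢.s x = b)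
      (hxc : 𝒢.r x = c) (hsa : 𝒢.s (𝒢.mul x y) = a) (hrc : 𝒢.r (𝒢.mul x y) = c) (v : fiber a),
      act (𝒢.mul x y) hsa hrc v = act x hxb hxc (act y hya hyb v))
    (S : Set (∀ a, fiber a))
    (dense : ∀ a, Dense (Submodule.span ℂ {v : fiber a | ∃ ξ ∈ S, ξ a = v} : Set (fiber a)))
    (cont : ∀ ξ ∈ S, ∀ η ∈ S,
      Continuous fun x : G => ⟪act x rfl rfl (ξ (𝒢.s x)), η (𝒢.r x)⟫_ℂ) :
    GHilbertBundle 𝒢 where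
  fiber := fiber
  sections := locallyApproximable (Submodule.span ℂ S)
  dense_sections a := by
    refine (dense a).mono ?_
    have : Submodule.span ℂ {v : fiber a | ∃ ξ ∈ S, ξ a = v} ≤
        (locallyApproximable (Submodule.span ℂ S)).map (LinearMap.proj a) := by
      refine Submodule.span_le.2 ?_
      rintro _ ⟨ξ, hξ, rfl⟩
      exact ⟨ξ, le_locallyApproximable _ (Submodule.subset_span hξ), rfl⟩
    intro v hv
    obtain ⟨ξ, hξ, h⟩ := this hv
    exact ⟨ξ, hξ, h⟩
  continuous_norm ξ hξ := by
    have h0 : ∀ ξ ∈ Submodule.span ℂ S, ∀ η ∈ Submodule.span ℂ S, _ := fun ξ hξ η hη =>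
      continuous_coeff_of_mem_span act S cont hξ hη
    exact continuous_norm_of_continuous_coeff act act_mul ξ
      (continuous_coeff_of_mem_locallyApproximable act _
        (fun η hη => continuous_norm_of_continuous_coeff act act_mul η (h0 η hη η hη)) h0 hξ hξ)
  mem_of_locally_approx := mem_locallyApproximable_of_approx _
  act := act
  act_mul := act_mul
  continuous_coeff ξ hξ η hη := by
    have h0 : ∀ ξ ∈ Submodule.span ℂ S, ∀ η ∈ Submodule.span ℂ S, _ := fun ξ hξ η hη =>
      continuous_coeff_of_mem_span act S cont hξ hη
    exact continuous_coeff_of_mem_locallyApproximable act _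
        (fun η hη => continuous_norm_of_continuous_coeff act act_mul η (h0 η hη η hη)) h0 hξ.1 hη.1

end Generators

/-! ### The norm and the algebra structure of `B(G)` -/

section Fourier

open TensorProduct UniformSpace
variable {G X : Type u} [TopologicalSpace G] [TopologicalSpace X] {𝒢 : TopGroupoid G X}

/-- `φ` is a coefficient `(ξ, η)` of bounded continuous sections with `‖ξ‖ ≤ p`, `‖η‖ ≤ q`. -/
def HasCoeffBound (𝒢 : TopGroupoid G X) (φ : G → ℂ) (p q : ℝ) : Prop :=
  ∃ H : GHilbertBundle 𝒢, ∃ ξ ∈ H.boundedSections, ∃ η ∈ H.boundedSections,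
    φ = TopGroupoid.coeff H ξ η ∧ (∀ a, ‖ξ a‖ ≤ p) ∧ ∀ a, ‖η a‖ ≤ q

/-- The trivial, direct sum, tensor product and induced bundles all enter through this lemma, so for
each of them only the generators need checking. -/
theorem hasCoeffBound_of_generators {fiber : X → Type u} [∀ a, NormedAddCommGroup (fiber a)]
    [∀ a, InnerProductSpace ℂ (fiber a)] [∀ a, CompleteSpace (fiber a)]
    [∀ a, TopologicalSpace.SeparableSpace (fiber a)]
    (act : ∀ (x : G) {a b : X}, 𝒢.s x = a → 𝒢.r x = b → (fiber a ≃ₗᵢ[ℂ] fiber b))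
    (act_mul : ∀ (x y : G) {a b c : X} (hya : 𝒢.s y = a) (hyb : 𝒢.r y = b) (hxb : 𝒢.s x = b)
      (hxc : 𝒢.r x = c) (hsa : 𝒢.s (𝒢.mul x y) = a) (hrc : 𝒢.r (𝒢.mul x y) = c) (v : fiber a),
      act (𝒢.mul x y) hsa hrc v = act x hxb hxc (act y hya hyb v))
    (S : Set (∀ a, fiber a))
    (dense : ∀ a, Dense (Submodule.span ℂ {v : fiber a | ∃ ξ ∈ S, ξ a = v} : Set (fiber a)))
    (cont : ∀ ξ ∈ S, ∀ η ∈ S,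
      Continuous fun x : G => ⟪act x rfl rfl (ξ (𝒢.s x)), η (𝒢.r x)⟫_ℂ)
    {ξ η : ∀ a, fiber a} (hξ : ξ ∈ locallyApproximable (Submodule.span ℂ S))
    (hη : η ∈ locallyApproximable (Submodule.span ℂ S)) {p q : ℝ} (hp : ∀ a, ‖ξ a‖ ≤ p)
    (hq : ∀ a, ‖η a‖ ≤ q) :
    HasCoeffBound 𝒢 (fun x => ⟪act x rfl rfl (ξ (𝒢.s x)), η (𝒢.r x)⟫_ℂ) p q :=
  ⟨GHilbertBundle.ofGenerators act act_mul S dense cont, ξ,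
    ⟨hξ, p, by rintro _ ⟨a, rfl⟩; exact hp a⟩, η, ⟨hη, q, by rintro _ ⟨a, rfl⟩; exact hq a⟩,
    rfl, hp, hq⟩

theorem exists_hasCoeffBound_of_mem {φ : G → ℂ} (h : φ ∈ 𝒢.fourierStieltjes) :
    ∃ C : ℝ, 0 < C ∧ HasCoeffBound 𝒢 φ C C := by
  obtain ⟨H, ξ, hξ, η, hη, rfl⟩ := h
  obtain ⟨C, hC, h1⟩ := HilbertBundle.exists_bound_of_mem hξ
  obtain ⟨D, hD, h2⟩ := HilbertBundle.exists_bound_of_mem hη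
  exact ⟨max C D, lt_max_of_lt_left hC, H, ξ, hξ, η, hη, rfl,
    fun a => (h1 a).trans (le_max_left _ _), fun a => (h2 a).trans (le_max_right _ _)⟩

namespace HasCoeffBound

variable {φ ψ : G → ℂ} {p q p' q' : ℝ}

theorem mem (h : HasCoeffBound 𝒢 φ p q) : φ ∈ 𝒢.fourierStieltjes :=
  let ⟨H, ξ, hξ, η, hη, h, _⟩ := h
  ⟨H, ξ, hξ, η, hη, h⟩

theorem mono (h : HasCoeffBound 𝒢 φ p q) (hp : p ≤ p') (hq : q ≤ q') :
    HasCoeffBound 𝒢 φ p' q' :=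
  let ⟨H, ξ, hξ, η, hη, h, h1, h2⟩ := h
  ⟨H, ξ, hξ, η, hη, h, fun a => (h1 a).trans hp, fun a => (h2 a).trans hq⟩

theorem fsNorm_le (h : HasCoeffBound 𝒢 φ p q) (hp : 0 ≤ p) (hq : 0 ≤ q) :
    𝒢.fsNorm φ ≤ p * q := by
  obtain ⟨H, ξ, hξ, η, hη, h, h1, h2⟩ := h
  have hbdd : BddBelow {c | ∃ H : GHilbertBundle 𝒢, ∃ ξ ∈ H.boundedSections,
      ∃ η ∈ H.boundedSections, φ = TopGroupoid.coeff H ξ η ∧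
        c = H.sectionNorm ξ * H.sectionNorm η} := by
    refine ⟨0, ?_⟩
    rintro _ ⟨H, ξ, _, η, _, _, rfl⟩
    exact mul_nonneg (Real.iSup_nonneg fun a => norm_nonneg _)
      (Real.iSup_nonneg fun a => norm_nonneg _)
  exact (csInf_le hbdd ⟨H, ξ, hξ, η, hη, h, rfl⟩).trans
    (mul_le_mul (Real.iSup_le h1 hp) (Real.iSup_le h2 hq)
      (Real.iSup_nonneg fun a => norm_nonneg _) hp)

theorem rescale (h : HasCoeffBound 𝒢 φ p q) {t : ℝ} (ht : 0 < t) :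
    HasCoeffBound 𝒢 φ (t * p) (t⁻¹ * q) := by
  obtain ⟨H, ξ, hξ, η, hη, rfl, h1, h2⟩ := h
  refine ⟨H, (t : ℂ) • ξ, HilbertBundle.smul_mem_boundedSections _ hξ, ((t⁻¹ : ℝ) : ℂ) • η,
    HilbertBundle.smul_mem_boundedSections _ hη, ?_, fun a => ?_, fun a => ?_⟩
  · funext x
    have : (t : ℂ) ≠ 0 := by exact_mod_cast ht.ne'
    simp only [TopGroupoid.coeff, Pi.smul_apply, map_smul, inner_smul_left, inner_smul_right,
      Complex.conj_ofReal, Complex.ofReal_inv]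
    field_simp
  · rw [Pi.smul_apply, norm_smul, Complex.norm_real, Real.norm_of_nonneg ht.le]
    exact mul_le_mul_of_nonneg_left (h1 a) ht.le
  · rw [Pi.smul_apply, norm_smul, Complex.norm_real, Real.norm_of_nonneg (inv_pos.2 ht).le]
    exact mul_le_mul_of_nonneg_left (h2 a) (inv_pos.2 ht).le

/-- Only the product of the bounds matters, by rescaling `ξ` against `η`. Equal bounds on both sides
add up under `HasCoeffBound.add`, which then serves as the triangle inequality. -/
theorem balance (h : HasCoeffBound 𝒢 φ p q) (hp : 0 ≤ p) (hq : 0 ≤ q) {δ : ℝ} (hδ : 0 < δ)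
    (hpq : p * q < δ ^ 2) : HasCoeffBound 𝒢 φ δ δ := by
  obtain ⟨p', hp', hpp', hpq'⟩ : ∃ p', 0 < p' ∧ p ≤ p' ∧ p' * q ≤ δ ^ 2 := by
    -- Since `p` may be `0`, it is enlarged to a positive number without pushing the product beyond
    -- `δ ^ 2`.
    refine ⟨p + (δ ^ 2 - p * q) / (q + 1), ?_, ?_, ?_⟩
    · have : 0 < (δ ^ 2 - p * q) / (q + 1) := div_pos (by linarith) (by linarith)
      linarith
    · have : 0 < (δ ^ 2 - p * q) / (q + 1) := div_pos (by linarith) (by linarith)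
      linarith
    · have : (δ ^ 2 - p * q) / (q + 1) * q ≤ δ ^ 2 - p * q := by
        rw [div_mul_eq_mul_div, div_le_iff₀ (by linarith)]
        nlinarith
      linarith
  refine (h.rescale (t := δ / p') (by positivity)).mono ?_ ?_
  · rw [div_mul_eq_mul_div, div_le_iff₀ hp']
    exact mul_le_mul_of_nonneg_left hpp' hδ.le
  · rw [inv_div, div_mul_eq_mul_div, div_le_iff₀ hδ]
    linarith

theorem const_smul (h : HasCoeffBound 𝒢 φ p q) (c : ℂ) : HasCoeffBound 𝒢 (c • φ) p (‖c‖ * q) := by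
  obtain ⟨H, ξ, hξ, η, hη, rfl, h1, h2⟩ := h
  refine ⟨H, ξ, hξ, c • η, HilbertBundle.smul_mem_boundedSections _ hη, ?_, h1, fun a => ?_⟩
  · funext x
    simp [TopGroupoid.coeff]
  · rw [Pi.smul_apply, norm_smul]
    exact mul_le_mul_of_nonneg_left (h2 a) (norm_nonneg c)

end HasCoeffBound

theorem hasCoeffBound_of_fsNorm_lt {φ : G → ℂ} (h : φ ∈ 𝒢.fourierStieltjes) {δ : ℝ} (hδ : 0 < δ)
    (hφ : 𝒢.fsNorm φ < δ ^ 2) : HasCoeffBound 𝒢 φ δ δ := by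
  have hne : {c | ∃ H : GHilbertBundle 𝒢, ∃ ξ ∈ H.boundedSections, ∃ η ∈ H.boundedSections,
      φ = TopGroupoid.coeff H ξ η ∧ c = H.sectionNorm ξ * H.sectionNorm η}.Nonempty := by
    obtain ⟨H, ξ, hξ, η, hη, h⟩ := h
    exact ⟨_, H, ξ, hξ, η, hη, h, rfl⟩
  obtain ⟨_, ⟨H, ξ, hξ, η, hη, h, rfl⟩, hlt⟩ := exists_lt_of_csInf_lt hne hφ
  exact HasCoeffBound.balance ⟨H, ξ, hξ, η, hη, h, fun a => le_ciSup hξ.2 a,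
    fun a => le_ciSup hη.2 a⟩ (Real.iSup_nonneg fun a => norm_nonneg _)
    (Real.iSup_nonneg fun a => norm_nonneg _) hδ hlt

theorem hasCoeffBound_one (𝒢 : TopGroupoid G X) : HasCoeffBound 𝒢 1 1 1 := by
  -- The fibres must live in `Type u`, hence this copy of `ℂ`.
  let e : EuclideanSpace ℂ PUnit.{u + 1} := EuclideanSpace.single PUnit.unit 1
  have he : ‖e‖ = 1 := by simp [e]
  have : TopologicalSpace.SeparableSpace (EuclideanSpace ℂ PUnit.{u + 1}) := inferInstance
  have key := hasCoeffBound_of_generators (𝒢 := 𝒢) (fiber := fun _ => EuclideanSpace ℂ PUnit.{u + 1})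
    (fun _ _ _ _ _ => LinearIsometryEquiv.refl ℂ _) (fun _ _ _ _ _ _ _ _ _ _ _ _ => rfl)
    {fun _ => e} (fun a => by
      refine dense_iff_closure_eq.2 (eq_univ_of_univ_subset fun v _ => subset_closure ?_)
      have : v = v PUnit.unit • e := by
        ext i; simp [e]
      rw [this]
      exact Submodule.smul_mem _ _ (Submodule.subset_span ⟨_, rfl, rfl⟩))
    (by rintro _ rfl _ rfl; exact continuous_const)
    (ξ := fun _ => e) (η := fun _ => e)
    (le_locallyApproximable _ (Submodule.subset_span rfl))
    (le_locallyApproximable _ (Submodule.subset_span rfl)) (fun _ => he.le) (fun _ => he.le)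
  convert key using 1
  funext x
  simp [e]

/-- The `ℓ²` direct sum of two linear isometry equivalences. -/
noncomputable def LinearIsometryEquiv.withLpProd {E F E' F' : Type*} [NormedAddCommGroup E]
    [NormedAddCommGroup F] [NormedAddCommGroup E'] [NormedAddCommGroup F'] [InnerProductSpace ℂ E]
    [InnerProductSpace ℂ F] [InnerProductSpace ℂ E'] [InnerProductSpace ℂ F']
    (f : E ≃ₗᵢ[ℂ] E') (g : F ≃ₗᵢ[ℂ] F') : WithLp 2 (E × F) ≃ₗᵢ[ℂ] WithLp 2 (E' × F') where
  toLinearEquiv := (WithLp.linearEquiv 2 ℂ (E × F)).trans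
    ((f.toLinearEquiv.prodCongr g.toLinearEquiv).trans (WithLp.linearEquiv 2 ℂ (E' × F')).symm)
  norm_map' v := by
    simp [WithLp.prod_norm_eq_of_L2]

theorem HasCoeffBound.add {φ ψ : G → ℂ} {p q p' q' : ℝ} (h : HasCoeffBound 𝒢 φ p q)
    (h' : HasCoeffBound 𝒢 ψ p' q') (hp : 0 ≤ p) (hq : 0 ≤ q) (hp' : 0 ≤ p') (hq' : 0 ≤ q') :
    HasCoeffBound 𝒢 (φ + ψ) (p + p') (q + q') := by
  obtain ⟨H, ξ, hξ, η, hη, rfl, h1, h2⟩ := h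
  obtain ⟨K, ξ', hξ', η', hη', rfl, h1', h2'⟩ := h'
  have hnorm : ∀ {E F : Type u} [NormedAddCommGroup E] [NormedAddCommGroup F]
      [InnerProductSpace ℂ E] [InnerProductSpace ℂ F] (v : E) (w : F) (p p' : ℝ), 0 ≤ p → 0 ≤ p' →
      ‖v‖ ≤ p → ‖w‖ ≤ p' → ‖WithLp.toLp 2 (v, w)‖ ≤ p + p' := by
    intro E F _ _ _ _ v w p p' hp hp' hv hw
    rw [WithLp.prod_norm_eq_of_L2]
    refine Real.sqrt_le_iff.2 ⟨by positivity, ?_⟩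
    change ‖v‖ ^ 2 + ‖w‖ ^ 2 ≤ _
    nlinarith [mul_nonneg hp hp', pow_le_pow_left₀ (norm_nonneg v) hv 2,
      pow_le_pow_left₀ (norm_nonneg w) hw 2]
  have : ∀ a, TopologicalSpace.SeparableSpace (WithLp 2 (H.fiber a × K.fiber a)) := fun a => by
    have := UniformSpace.secondCountable_of_separable (H.fiber a)
    have := UniformSpace.secondCountable_of_separable (K.fiber a)
    infer_instance
  let S : Set (∀ a, WithLp 2 (H.fiber a × K.fiber a)) :=
    {σ | ∃ α ∈ H.boundedSections, ∃ β ∈ K.boundedSections, σ = fun a => WithLp.toLp 2 (α a, β a)}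
  have hS : ∀ α ∈ H.boundedSections, ∀ β ∈ K.boundedSections,
      (fun a => WithLp.toLp 2 (α a, β a)) ∈ locallyApproximable (Submodule.span ℂ S) :=
    fun α hα β hβ => le_locallyApproximable _ (Submodule.subset_span ⟨α, hα, β, hβ, rfl⟩)
  have key := hasCoeffBound_of_generators (𝒢 := 𝒢) (fiber := fun a => WithLp 2 (H.fiber a × K.fiber a))
    (fun x _ _ ha hb => (H.act x ha hb).withLpProd (K.act x ha hb))
    (fun x y _ _ _ hya hyb hxb hxc hsa hrc v => by
      change WithLp.toLp 2 (_, _) = WithLp.toLp 2 (_, _)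
      congr 2
      · exact H.act_mul x y hya hyb hxb hxc hsa hrc _
      · exact K.act_mul x y hya hyb hxb hxc hsa hrc _)
    S (fun a => by
      refine Dense.mono Submodule.subset_span ?_
      have hd := (H.dense_boundedSections a).prod (K.dense_boundedSections a)
      have hd' := (WithLp.homeomorphProd 2 (H.fiber a) (K.fiber a)).symm.surjective.denseRange.dense_image
        (WithLp.homeomorphProd 2 (H.fiber a) (K.fiber a)).symm.continuous hd
      refine hd'.mono ?_
      rintro _ ⟨⟨v, w⟩, ⟨⟨α, hα, rfl⟩, ⟨β, hβ, rfl⟩⟩, rfl⟩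
      exact ⟨_, ⟨α, hα, β, hβ, rfl⟩, rfl⟩)
    (by
      rintro _ ⟨α, hα, β, hβ, rfl⟩ _ ⟨α', hα', β', hβ', rfl⟩
      exact (H.continuous_coeff α hα α' hα').add (K.continuous_coeff β hβ β' hβ'))
    (hS ξ hξ ξ' hξ') (hS η hη η' hη') (fun a => hnorm _ _ p p' hp hp' (h1 a) (h1' a))
    (fun a => hnorm _ _ q q' hq hq' (h2 a) (h2' a))
  exact key

/-- The action of a pair of unitaries on the completed tensor product. -/
noncomputable def LinearIsometryEquiv.completedTensor {E F E' F' : Type*} [NormedAddCommGroup E]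
    [NormedAddCommGroup F] [NormedAddCommGroup E'] [NormedAddCommGroup F'] [InnerProductSpace ℂ E]
    [InnerProductSpace ℂ F] [InnerProductSpace ℂ E'] [InnerProductSpace ℂ F']
    (f : E ≃ₗᵢ[ℂ] E') (g : F ≃ₗᵢ[ℂ] F') :
    Completion (E ⊗[ℂ] F) ≃ₗᵢ[ℂ] Completion (E' ⊗[ℂ] F') :=
  (TensorProduct.congrIsometry f g).toLinearEquiv.extendOfIsometry
    (Completion.toComplₗᵢ (𝕜 := ℂ) (E := E ⊗[ℂ] F)).toLinearMap
    (Completion.toComplₗᵢ (𝕜 := ℂ) (E := E' ⊗[ℂ] F')).toLinearMap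
    Completion.denseRange_coe Completion.denseRange_coe
    (fun v => (Completion.norm_coe _).trans
      (((TensorProduct.congrIsometry f g).norm_map v).trans (Completion.norm_coe v).symm))

theorem LinearIsometryEquiv.completedTensor_coe {E F E' F' : Type*} [NormedAddCommGroup E]
    [NormedAddCommGroup F] [NormedAddCommGroup E'] [NormedAddCommGroup F'] [InnerProductSpace ℂ E]
    [InnerProductSpace ℂ F] [InnerProductSpace ℂ E'] [InnerProductSpace ℂ F']
    (f : E ≃ₗᵢ[ℂ] E') (g : F ≃ₗᵢ[ℂ] F') (v : E ⊗[ℂ] F) :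
    f.completedTensor g (v : Completion (E ⊗[ℂ] F)) =
      (TensorProduct.congrIsometry f g v : E' ⊗[ℂ] F') :=
  LinearEquiv.extendOfIsometry_eq (TensorProduct.congrIsometry f g).toLinearEquiv
    (Completion.toComplₗᵢ (𝕜 := ℂ) (E := E ⊗[ℂ] F)).toLinearMap
    (Completion.toComplₗᵢ (𝕜 := ℂ) (E := E' ⊗[ℂ] F')).toLinearMap _ _ _ v

theorem separableSpace_tensorProduct {E F : Type*} [NormedAddCommGroup E] [NormedAddCommGroup F]
    [InnerProductSpace ℂ E] [InnerProductSpace ℂ F] [TopologicalSpace.SeparableSpace E]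
    [TopologicalSpace.SeparableSpace F] : TopologicalSpace.SeparableSpace (E ⊗[ℂ] F) := by
  rw [← TopologicalSpace.isSeparable_univ_iff]
  have h := (TopologicalSpace.isSeparable_range
    (TensorProduct.continuous_tmul (𝕜 := ℂ) (E := E) (F := F))).span (R := ℂ)
  refine h.mono fun v _ => ?_
  have := TensorProduct.span_tmul_eq_top ℂ E F ▸ Submodule.mem_top (x := v)
  refine Submodule.span_mono ?_ this
  rintro _ ⟨a, b, rfl⟩
  exact ⟨(a, b), rfl⟩

/-- On the fibrewise completed tensor product, generated by the sections `α ⊗ β`, inner products of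
pure tensors factor, so the coefficients multiply. -/
theorem HasCoeffBound.mul {φ ψ : G → ℂ} {p q p' q' : ℝ} (h : HasCoeffBound 𝒢 φ p q)
    (h' : HasCoeffBound 𝒢 ψ p' q') (hp : 0 ≤ p) (hq : 0 ≤ q) :
    HasCoeffBound 𝒢 (φ * ψ) (p * p') (q * q') := by
  obtain ⟨H, ξ, hξ, η, hη, rfl, h1, h2⟩ := h
  obtain ⟨K, ξ', hξ', η', hη', rfl, h1', h2'⟩ := h'
  have : ∀ a, TopologicalSpace.SeparableSpace (H.fiber a ⊗[ℂ] K.fiber a) := fun a =>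
    separableSpace_tensorProduct
  let S : Set (∀ a, Completion (H.fiber a ⊗[ℂ] K.fiber a)) :=
    {σ | ∃ α ∈ H.boundedSections, ∃ β ∈ K.boundedSections,
      σ = fun a => ((α a ⊗ₜ[ℂ] β a : H.fiber a ⊗[ℂ] K.fiber a) : Completion _)}
  have hS : ∀ α ∈ H.boundedSections, ∀ β ∈ K.boundedSections,
      (fun a => ((α a ⊗ₜ[ℂ] β a : H.fiber a ⊗[ℂ] K.fiber a) : Completion _)) ∈
        locallyApproximable (Submodule.span ℂ S) :=
    fun α hα β hβ => le_locallyApproximable _ (Submodule.subset_span ⟨α, hα, β, hβ, rfl⟩)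
  have hco : ∀ (α α' : ∀ a, H.fiber a) (β β' : ∀ a, K.fiber a) (x : G),
      ⟪(H.act x rfl rfl).completedTensor (K.act x rfl rfl)
        ((α (𝒢.s x) ⊗ₜ[ℂ] β (𝒢.s x) : H.fiber (𝒢.s x) ⊗[ℂ] K.fiber (𝒢.s x)) : Completion _),
        ((α' (𝒢.r x) ⊗ₜ[ℂ] β' (𝒢.r x) : H.fiber (𝒢.r x) ⊗[ℂ] K.fiber (𝒢.r x)) :
          Completion _)⟫_ℂ = TopGroupoid.coeff H α α' x * TopGroupoid.coeff K β β' x := by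
    intro α α' β β' x
    rw [LinearIsometryEquiv.completedTensor_coe, Completion.inner_coe]
    simp [TopGroupoid.coeff]
  have key := hasCoeffBound_of_generators (𝒢 := 𝒢)
    (fiber := fun a => Completion (H.fiber a ⊗[ℂ] K.fiber a))
    (fun x _ _ ha hb => (H.act x ha hb).completedTensor (K.act x ha hb))
    (fun x y _ _ _ hya hyb hxb hxc hsa hrc v => by
      refine Completion.induction_on v ?_ fun v => ?_
      · refine isClosed_eq (LinearIsometryEquiv.continuous _) ?_
        exact (LinearIsometryEquiv.continuous _).comp (LinearIsometryEquiv.continuous _)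
      · simp only [LinearIsometryEquiv.completedTensor_coe]
        congr 1
        induction v with
        | zero => simp
        | add v w hv hw => simp only [map_add, hv, hw]
        | tmul v w =>
          exact congrArg₂ (fun v w => v ⊗ₜ[ℂ] w) (H.act_mul x y hya hyb hxb hxc hsa hrc v)
            (K.act_mul x y hya hyb hxb hxc hsa hrc w))
    S (fun a => by
      let T : Submodule ℂ (Completion (H.fiber a ⊗[ℂ] K.fiber a)) :=
        (Submodule.span ℂ {v | ∃ ξ ∈ S, ξ a = v}).topologicalClosure
      have hT : IsClosed (T : Set (Completion (H.fiber a ⊗[ℂ] K.fiber a))) :=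
        Submodule.isClosed_topologicalClosure _
      have hpure : ∀ (v : H.fiber a) (w : K.fiber a),
          ((v ⊗ₜ[ℂ] w : H.fiber a ⊗[ℂ] K.fiber a) : Completion (H.fiber a ⊗[ℂ] K.fiber a)) ∈ T := by
        have hc : Continuous fun z : H.fiber a × K.fiber a =>
            ((z.1 ⊗ₜ[ℂ] z.2 : H.fiber a ⊗[ℂ] K.fiber a) : Completion (H.fiber a ⊗[ℂ] K.fiber a)) :=
          (Completion.continuous_coe _).comp
            (TensorProduct.continuous_tmul (𝕜 := ℂ) (E := H.fiber a) (F := K.fiber a))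
        have hd := (H.dense_boundedSections a).prod (K.dense_boundedSections a)
        intro v w
        refine hd.induction (P := fun z : H.fiber a × K.fiber a =>
          ((z.1 ⊗ₜ[ℂ] z.2 : H.fiber a ⊗[ℂ] K.fiber a) : Completion (H.fiber a ⊗[ℂ] K.fiber a)) ∈ T) ?_
          (hT.preimage hc) (v, w)
        rintro ⟨_, _⟩ ⟨⟨α, hα, rfl⟩, ⟨β, hβ, rfl⟩⟩
        exact Submodule.le_topologicalClosure _
          (Submodule.subset_span ⟨_, ⟨α, hα, β, hβ, rfl⟩, rfl⟩)
      intro v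
      change v ∈ T
      induction v using Completion.induction_on with
      | hp => exact hT
      | ih v =>
        induction v with
        | zero => exact T.zero_mem
        | add v w hv hw => rw [Completion.coe_add]; exact T.add_mem hv hw
        | tmul v w => exact hpure v w)
    (by
      rintro _ ⟨α, hα, β, hβ, rfl⟩ _ ⟨α', hα', β', hβ', rfl⟩
      simp_rw [hco]
      exact (H.continuous_coeff α hα α' hα').mul (K.continuous_coeff β hβ β' hβ'))
    (hS ξ hξ ξ' hξ') (hS η hη η' hη') (p := p * p') (q := q * q') (fun a => by
      rw [Completion.norm_coe, TensorProduct.norm_tmul]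
      exact mul_le_mul (h1 a) (h1' a) (norm_nonneg _) hp)
    (fun a => by
      rw [Completion.norm_coe, TensorProduct.norm_tmul]
      exact mul_le_mul (h2 a) (h2' a) (norm_nonneg _) hq)
  simp_rw [hco] at key
  exact key

/-- The Fourier-Stieltjes algebra as a unital subalgebra of the algebra of functions on `G`. -/
def fourierStieltjesSubalgebra (𝒢 : TopGroupoid G X) : Subalgebra ℂ (G → ℂ) where
  carrier := 𝒢.fourierStieltjes
  mul_mem' := by
    intro φ ψ h h'
    obtain ⟨C, hC, h⟩ := exists_hasCoeffBound_of_mem h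
    obtain ⟨D, hD, h'⟩ := exists_hasCoeffBound_of_mem h'
    exact (h.mul h' hC.le hC.le).mem
  add_mem' := by
    intro φ ψ h h'
    obtain ⟨C, hC, h⟩ := exists_hasCoeffBound_of_mem h
    obtain ⟨D, hD, h'⟩ := exists_hasCoeffBound_of_mem h'
    exact (h.add h' hC.le hC.le hD.le hD.le).mem
  algebraMap_mem' := by
    intro c
    rw [Algebra.algebraMap_eq_smul_one]
    exact ((hasCoeffBound_one 𝒢).const_smul c).mem

end Fourier

/-! ### `r`-discrete groupoids: local structure of `r` and atomic Haar systems -/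

section RDiscrete

theorem exists_compactlySupported_eq_one {G : Type*} [TopologicalSpace G] [T2Space G]
    [LocallyCompactSpace G] {U : Set G} (hU : IsOpen U) {t : G} (ht : t ∈ U) :
    ∃ f : C_c(G, ℂ), (∀ᶠ y in 𝓝 t, f y = 1) ∧ ∀ y, f y ≠ 0 → y ∈ U := by
  obtain ⟨K, hK, htK, hKU⟩ := exists_compact_subset hU ht
  obtain ⟨f, hf1, hf2, hf3⟩ := exists_continuousMap_one_of_isCompact_subset_isOpen hK hU hKU
  have hsub : ∀ y, (f y : ℂ) ≠ 0 → f y ≠ 0 := fun y hy h => hy (by simp [h])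
  refine ⟨⟨⟨fun y => (f y : ℂ), by fun_prop⟩, ?_⟩, ?_, fun y hy => ?_⟩
  · exact HasCompactSupport.comp_left (g := fun c : ℝ => (c : ℂ)) hf2 Complex.ofReal_zero
  · filter_upwards [mem_interior_iff_mem_nhds.1 htK] with y hy
    have : f y = 1 := hf1 hy
    exact (congrArg _ this).trans Complex.ofReal_one
  · exact hf3.1 (subset_tsupport _ (hsub y hy))

variable {G X : Type u} [TopologicalSpace G] [TopologicalSpace X]

namespace TopGroupoid

variable (𝒢 : TopGroupoid G X)

theorem t2Space_units (𝒢 : TopGroupoid G X) [T2Space G] : T2Space X :=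
  (Function.LeftInverse.isEmbedding 𝒢.r_unit 𝒢.continuous_r 𝒢.continuous_unit).t2Space

theorem mul_inv_cancel_left' {x t : G} (h : 𝒢.r t = 𝒢.r x) :
    𝒢.mul x (𝒢.mul (𝒢.inv x) t) = t := by
  rw [← 𝒢.mul_assoc x (𝒢.inv x) t (𝒢.r_inv x).symm (by rw [𝒢.s_inv, h]), 𝒢.mul_inv, ← h,
    𝒢.unit_mul]

theorem inv_mul_cancel_left' {x t : G} (h : 𝒢.r t = 𝒢.s x) :
    𝒢.mul (𝒢.inv x) (𝒢.mul x t) = t := by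
  rw [← 𝒢.mul_assoc (𝒢.inv x) x t (𝒢.s_inv x) h.symm, 𝒢.inv_mul, ← h, 𝒢.unit_mul]

theorem r_inv_mul {x t : G} (h : 𝒢.r t = 𝒢.r x) : 𝒢.r (𝒢.mul (𝒢.inv x) t) = 𝒢.s x := by
  rw [𝒢.r_mul _ _ (by rw [𝒢.s_inv, h]), 𝒢.r_inv]

theorem s_inv_mul {x t : G} (h : 𝒢.r t = 𝒢.r x) : 𝒢.s (𝒢.mul (𝒢.inv x) t) = 𝒢.s t :=
  𝒢.s_mul _ _ (by rw [𝒢.s_inv, h])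

theorem continuousOn_inv_mul :
    ContinuousOn (fun z : G × G => 𝒢.mul (𝒢.inv z.1) z.2) {z | 𝒢.r z.2 = 𝒢.r z.1} := by
  refine 𝒢.continuousOn_mul.comp (f := fun z : G × G => (𝒢.inv z.1, z.2))
    ((𝒢.continuous_inv.comp continuous_fst).prodMk continuous_snd).continuousOn ?_
  intro z hz
  exact (𝒢.s_inv z.1).trans (Eq.symm hz)

variable {𝒢}

/-- The range map of an `r`-discrete groupoid is locally injective. -/
theorem IsRDiscrete.exists_injOn_r (hG : 𝒢.IsRDiscrete) (t : G) :
    ∃ U : Set G, IsOpen U ∧ t ∈ U ∧ InjOn 𝒢.r U := by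
  -- The map `(x, y) ↦ x⁻¹y` sends `(t, t)` to a unit. As the units are open, `x⁻¹y` is a unit, that
  -- is `x = y`, for all `x`, `y` near `t` with the same range.
  have hc := 𝒢.continuousOn_inv_mul (t, t) rfl
  have hmem : range 𝒢.unit ∈ 𝓝 (𝒢.mul (𝒢.inv t) t) :=
    hG.mem_nhds ⟨𝒢.s t, (𝒢.inv_mul t).symm⟩
  have hev := hc.eventually hmem
  rw [eventually_nhdsWithin_iff, nhds_prod_eq] at hev
  replace hev := (eventually_prod_self_iff (r := fun x y => 𝒢.r y = 𝒢.r x →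
    ∃ a, 𝒢.unit a = 𝒢.mul (𝒢.inv x) y)).1 hev
  obtain ⟨W, hW, hWW⟩ := hev
  obtain ⟨U, hUW, hU, htU⟩ := mem_nhds_iff.1 hW
  refine ⟨U, hU, htU, fun x hx y hy hxy => ?_⟩
  obtain ⟨a, ha⟩ := hWW x (hUW hx) y (hUW hy) hxy.symm
  have h1 := 𝒢.mul_inv_cancel_left' hxy.symm
  have h2 : a = 𝒢.s x := by
    rw [← 𝒢.r_inv_mul hxy.symm, ← ha, 𝒢.r_unit]
  rw [← ha, h2, 𝒢.mul_unit] at h1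
  exact h1

theorem IsRDiscrete.finite_inter_fiber [T2Space X] (hG : 𝒢.IsRDiscrete) {K : Set G}
    (hK : IsCompact K) (a : X) : (K ∩ 𝒢.r ⁻¹' {a}).Finite := by
  choose U hU htU hinj using hG.exists_injOn_r
  have hc : IsCompact (K ∩ 𝒢.r ⁻¹' {a}) :=
    hK.inter_right (isClosed_singleton.preimage 𝒢.continuous_r)
  obtain ⟨F, hF, hcov⟩ := hc.elim_nhds_subcover U fun t _ => (hU t).mem_nhds (htU t)
  refine F.finite_toSet.subset fun z hz => ?_
  obtain ⟨t, ht, hzt⟩ := mem_iUnion₂.1 (hcov hz)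
  have : z = t := hinj t hzt (htU t) ((hz.2 : 𝒢.r z = a).trans (hF t ht).2.symm)
  rwa [this]

/-- Countably many open sets on which `r` is injective cover `G`. This makes the `ℓ²`-fibres of the
induced bundle separable. -/
theorem IsRDiscrete.countable_fiber [SecondCountableTopology G] (hG : 𝒢.IsRDiscrete) (a : X) :
    Countable {t // 𝒢.r t = a} := by
  choose U hU htU hinj using hG.exists_injOn_r
  obtain ⟨F, hF, hcov⟩ := TopologicalSpace.countable_cover_nhds
    fun t => (hU t).mem_nhds (htU t)
  have : (⋃ t ∈ F, U t ∩ 𝒢.r ⁻¹' {a}).Countable := hF.biUnion fun t _ => by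
    refine Set.Subsingleton.countable fun x hx y hy => hinj t hx.1 hy.1 ?_
    exact (hx.2 : 𝒢.r x = a).trans (hy.2 : 𝒢.r y = a).symm
  refine (this.mono fun z hz => ?_ : (𝒢.r ⁻¹' {a}).Countable).to_subtype
  obtain ⟨t, ht, hzt⟩ := mem_iUnion₂.1 (hcov ▸ mem_univ z)
  exact mem_iUnion₂.2 ⟨t, ht, hzt, hz⟩

section Haar

variable [SecondCountableTopology G] [MeasurableSpace G] {lam : X → Measure G}

theorem IsHaarSystem.ae_r_eq (hlam : 𝒢.IsHaarSystem lam) (a : X) : ∀ᵐ y ∂lam a, 𝒢.r y = a := by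
  have h := (lam a).support_mem_ae
  rw [hlam.support_eq] at h
  exact h

/-- A neighbourhood of `t` on which `r` is injective has positive measure, and meets the fibre only
in `t`. -/
theorem IsHaarSystem.measureReal_singleton_pos (hlam : 𝒢.IsHaarSystem lam) (hG : 𝒢.IsRDiscrete)
    (t : G) : 0 < (lam (𝒢.r t)).real {t} := by
  have := hlam.finite_on_compacts (𝒢.r t)
  refine ENNReal.toReal_pos (ne_of_gt ?_) (isCompact_singleton.measure_lt_top).ne
  obtain ⟨U, hU, htU, hinj⟩ := hG.exists_injOn_r t
  have h1 : t ∈ (lam (𝒢.r t)).support := by rw [hlam.support_eq]; rfl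
  refine ((lam (𝒢.r t)).mem_support_iff_forall t |>.1 h1 U (hU.mem_nhds htU)).trans_le
    (measure_mono_ae ?_)
  filter_upwards [hlam.ae_r_eq (𝒢.r t)] with y hy hyU
  exact hinj hyU htU hy

variable [T2Space G] [BorelSpace G]

/-- No measurability of `h` is needed, which matters because integrands such as `f (x⁻¹t)` involve
arbitrary values of `mul` off the fibre. -/
theorem IsHaarSystem.integral_eq_sum (hlam : 𝒢.IsHaarSystem lam) {a : X} (T : Finset G)
    {h : G → ℂ} (hT : ∀ y, 𝒢.r y = a → h y ≠ 0 → y ∈ T) :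
    ∫ y, h y ∂lam a = ∑ t ∈ T, (lam a).real {t} • h t := by
  have := hlam.finite_on_compacts a
  have hae : h =ᵐ[lam a] fun y => ∑ t ∈ T, indicator {t} (fun _ => h t) y := by
    filter_upwards [hlam.ae_r_eq a] with y hy
    by_cases hyT : y ∈ T
    · rw [Finset.sum_eq_single_of_mem y hyT fun t _ hty => indicator_of_notMem (by
        simpa using hty.symm) _]
      simp
    · rw [Finset.sum_eq_zero fun t ht => indicator_of_notMem (fun h' => hyT (by
        rw [mem_singleton_iff] at h'; rwa [h'])) _]
      by_contra hne
      exact hyT (hT y hy hne)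
  rw [integral_congr_ae hae, integral_finsetSum]
  · refine Finset.sum_congr rfl fun t _ => ?_
    rw [integral_indicator (measurableSet_singleton t), integral_singleton]
  · intro t _
    exact (integrable_indicator_iff (measurableSet_singleton t)).2
      (integrableOn_const (isCompact_singleton.measure_lt_top (μ := lam a)).ne)

variable [LocallyCompactSpace G]

/-- For a bump function `f` at `t` supported in `W`, the function `a ↦ ∫ f dλ^a` is continuous and
nonzero at `r t`, but vanishes wherever the fibre misses `W`. -/
theorem IsHaarSystem.isOpenMap_r (hlam : 𝒢.IsHaarSystem lam) (hG : 𝒢.IsRDiscrete) :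
    IsOpenMap 𝒢.r := by
  refine IsOpenMap.of_nhds_le fun t => ?_
  refine le_map fun W hW => ?_
  obtain ⟨U, hU, htU, hinj⟩ := hG.exists_injOn_r t
  obtain ⟨f, hf1, hf2⟩ := exists_compactlySupported_eq_one (hU.inter isOpen_interior)
    (show t ∈ U ∩ interior W from ⟨htU, mem_interior_iff_mem_nhds.2 hW⟩)
  have hne : ∫ y, f y ∂lam (𝒢.r t) ≠ 0 := by
    rw [hlam.integral_eq_sum {t} fun y hy hfy =>
      Finset.mem_singleton.2 (hinj (hf2 y hfy).1 htU hy), Finset.sum_singleton, hf1.self_of_nhds]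
    simpa using (hlam.measureReal_singleton_pos hG t).ne'
  filter_upwards [(hlam.continuous_integral f).continuousAt.eventually_ne hne] with a ha
  by_contra hcon
  refine ha ?_
  rw [hlam.integral_eq_sum ∅ fun y hy hfy =>
    (hcon ⟨y, interior_subset (hf2 y hfy).2, hy⟩).elim, Finset.sum_empty]

theorem IsHaarSystem.isLocalHomeomorph_r (hlam : 𝒢.IsHaarSystem lam) (hG : 𝒢.IsRDiscrete) :
    IsLocalHomeomorph 𝒢.r := by
  rw [isLocalHomeomorph_iff_isOpenEmbedding_restrict]
  intro t
  obtain ⟨U, hU, htU, hinj⟩ := hG.exists_injOn_r t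
  exact ⟨U, hU.mem_nhds htU, .of_continuous_injective_isOpenMap
    (𝒢.continuous_r.comp continuous_subtype_val) (injOn_iff_injective.1 hinj)
    ((hlam.isOpenMap_r hG).domRestrict hU)⟩

/-- Left translation by `x` carries the unit at `s x` to `x`; invariance is tested on a bump
function at `x`. -/
theorem IsHaarSystem.measureReal_singleton (hlam : 𝒢.IsHaarSystem lam) (hG : 𝒢.IsRDiscrete)
    (x : G) : (lam (𝒢.r x)).real {x} = (lam (𝒢.s x)).real {𝒢.unit (𝒢.s x)} := by
  obtain ⟨U, hU, hxU, hinj⟩ := hG.exists_injOn_r x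
  obtain ⟨f, hf1, hf2⟩ := exists_compactlySupported_eq_one hU hxU
  have h := hlam.left_invariant x f
  rw [hlam.integral_eq_sum {x} fun y hy hfy => Finset.mem_singleton.2 (hinj (hf2 y hfy) hxU hy),
    hlam.integral_eq_sum {𝒢.unit (𝒢.s x)}, Finset.sum_singleton, Finset.sum_singleton,
    𝒢.mul_unit, hf1.self_of_nhds] at h
  · simpa using h.symm
  · intro y hy hfy
    have h1 : 𝒢.mul x y = x := hinj (hf2 _ hfy) hxU (𝒢.r_mul x y hy.symm)
    have h2 := 𝒢.inv_mul_cancel_left' hy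
    rw [h1, 𝒢.inv_mul] at h2
    exact Finset.mem_singleton.2 h2.symm

/-- Near `a₀` the mass of the unit is the integral of a bump function supported in the open unit
space. -/
theorem IsHaarSystem.continuous_measureReal_unit (hlam : 𝒢.IsHaarSystem lam)
    (hG : 𝒢.IsRDiscrete) : Continuous fun a => ((lam a).real {𝒢.unit a} : ℂ) := by
  refine continuous_iff_continuousAt.2 fun a₀ => ?_
  obtain ⟨f, hf1, hf2⟩ := exists_compactlySupported_eq_one hG (mem_range_self (f := 𝒢.unit) a₀)
  refine (hlam.continuous_integral f).continuousAt.congr ?_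
  filter_upwards [𝒢.continuous_unit.continuousAt.eventually hf1] with a ha
  rw [hlam.integral_eq_sum {𝒢.unit a}, Finset.sum_singleton, ha]
  · simp
  · intro y hy hfy
    obtain ⟨b, rfl⟩ := hf2 y hfy
    rw [𝒢.r_unit] at hy
    rw [hy, Finset.mem_singleton]

end Haar

theorem tsum_fiber_eq_sum {E : Type*} [AddCommMonoid E] [TopologicalSpace E] {a : X} (T : Finset G)
    {h : G → E} (hT : ∀ t ∈ T, 𝒢.r t = a) (hT' : ∀ t, 𝒢.r t = a → h t ≠ 0 → t ∈ T) :
    ∑' t : {t // 𝒢.r t = a}, h t = ∑ t ∈ T, h t := by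
  refine (tsum_subtype {t | 𝒢.r t = a} h).trans ?_
  rw [tsum_eq_sum (s := T)]
  · exact Finset.sum_congr rfl fun t ht => indicator_of_mem (s := {t | 𝒢.r t = a}) (hT t ht) h
  · intro t ht
    rw [indicator_apply_eq_zero]
    intro hta
    by_contra hne
    exact ht (hT' t hta hne)

/-- Sums along the fibres of the range map depend continuously on the fibre. -/
theorem continuous_tsum_fiber [T2Space G] [T2Space X] {E Y : Type*} [AddCommMonoid E]
    [TopologicalSpace E] [ContinuousAdd E] [TopologicalSpace Y] (hG : 𝒢.IsRDiscrete)
    (hr : IsLocalHomeomorph 𝒢.r)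
    {p : Y → X} (hp : Continuous p) {K : Set G} (hK : IsCompact K) {h : Y → G → E}
    (hhK : ∀ y t, h y t ≠ 0 → t ∈ K)
    (hh : ContinuousOn (fun z : Y × G => h z.1 z.2) {z | 𝒢.r z.2 = p z.1}) :
    Continuous fun y => ∑' t : {t // 𝒢.r t = p y}, h y t := by
  classical
  refine continuous_iff_continuousAt.2 fun y₀ => ?_
  -- Near `y₀`, the local inverses of `r` at the finitely many points of `K` over `p y₀` have
  -- distinct values that include all points of `K` over `p y`. So the sum is locally a finite sum
  -- of continuous functions.
  choose e he hre using hr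
  have hfin := hG.finite_inter_fiber hK (p y₀)
  set T : Finset G := hfin.toFinset with hTdef
  have hT : ∀ t ∈ T, t ∈ K ∧ 𝒢.r t = p y₀ := fun t ht => hfin.mem_toFinset.1 ht
  have hsymm : ∀ t ∈ T, (e t).symm (p y₀) = t := by
    intro t ht
    rw [← (hT t ht).2]
    have := (e t).left_inv (he t)
    rwa [← hre t] at this
  have hmemt : ∀ t ∈ T, p y₀ ∈ (e t).target := by
    intro t ht
    rw [← (hT t ht).2]
    have := (e t).map_source (he t)
    rwa [← hre t] at this
  have hcont : ∀ t ∈ T, Tendsto (fun y => (e t).symm (p y)) (𝓝 y₀) (𝓝 t) := by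
    intro t ht
    have h1 := ((e t).symm.continuousAt (hmemt t ht)).comp hp.continuousAt
    have h2 : Tendsto (fun y => (e t).symm (p y)) (𝓝 y₀) (𝓝 ((e t).symm (p y₀))) := h1
    rwa [hsymm t ht] at h2
  have hright : ∀ t ∈ T, ∀ᶠ y in 𝓝 y₀, 𝒢.r ((e t).symm (p y)) = p y := by
    intro t ht
    filter_upwards [hp.continuousAt.eventually ((e t).open_target.mem_nhds (hmemt t ht))] with y hy
    have := (e t).right_inv hy
    rwa [← hre t] at this
  have hdist : ∀ t ∈ T, ∀ t' ∈ T, t ≠ t' → ∀ᶠ y in 𝓝 y₀, (e t).symm (p y) ≠ (e t').symm (p y) :=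
    fun t ht t' ht' hne => ((hcont t ht).prodMk_nhds (hcont t' ht')).eventually
      (isClosed_diagonal.isOpen_compl.mem_nhds hne)
  -- The part of `K` outside the charts has a compact, hence closed, image under `r`, and this image
  -- misses `p y₀`.
  have hcover : ∀ᶠ y in 𝓝 y₀, ∀ z ∈ K, 𝒢.r z = p y → ∃ t ∈ T, z ∈ (e t).source := by
    have hL : IsCompact (K \ ⋃ t ∈ T, (e t).source) :=
      hK.diff (isOpen_biUnion fun t _ => (e t).open_source)
    have hcl : IsClosed (𝒢.r '' (K \ ⋃ t ∈ T, (e t).source)) :=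
      (hL.image 𝒢.continuous_r).isClosed
    have hnot : p y₀ ∉ 𝒢.r '' (K \ ⋃ t ∈ T, (e t).source) := by
      rintro ⟨z, ⟨hzK, hz⟩, hza⟩
      exact hz (mem_iUnion₂.2 ⟨z, hfin.mem_toFinset.2 ⟨hzK, hza⟩, he z⟩)
    filter_upwards [hp.continuousAt.eventually (hcl.isOpen_compl.mem_nhds hnot)] with y hy z hz hzr
    by_contra hcon
    refine hy ⟨z, ⟨hz, fun hz' => hcon ?_⟩, hzr⟩
    obtain ⟨t, ht, hzt⟩ := mem_iUnion₂.1 hz'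
    exact ⟨t, ht, hzt⟩
  have hsum : ∀ᶠ y in 𝓝 y₀, ∑ t ∈ T, h y ((e t).symm (p y)) =
      ∑' t : {t // 𝒢.r t = p y}, h y t := by
    have h1 := (Finset.eventually_all T).2 hright
    have h2 : ∀ᶠ y in 𝓝 y₀, ∀ t ∈ T, ∀ t' ∈ T, t ≠ t' → (e t).symm (p y) ≠ (e t').symm (p y) := by
      refine (Finset.eventually_all T).2 fun t ht => (Finset.eventually_all T).2 fun t' ht' => ?_
      by_cases hne : t = t'
      · simp [hne]
      · filter_upwards [hdist t ht t' ht' hne] with y hy _ using hy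
    filter_upwards [h1, h2, hcover] with y h1 h2 h3
    rw [tsum_fiber_eq_sum (T.image fun t => (e t).symm (p y)), Finset.sum_image]
    · intro t ht t' ht' heq
      by_contra hne
      exact h2 t ht t' ht' hne heq
    · intro z hz
      obtain ⟨t, ht, rfl⟩ := Finset.mem_image.1 hz
      exact h1 t ht
    · intro z hz hne
      obtain ⟨t, ht, hzt⟩ := h3 z (hhK y z hne) hz
      refine Finset.mem_image.2 ⟨t, ht, ?_⟩
      have := (e t).left_inv hzt
      rw [← hre t] at this
      rwa [← hz]
  refine ContinuousAt.congr ?_ hsum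
  refine tendsto_finsetSum T fun t ht => ?_
  have h1 := hh (y₀, t) (hT t ht).2
  have h2 : Tendsto (fun y => (y, (e t).symm (p y))) (𝓝 y₀)
      (𝓝[{z : Y × G | 𝒢.r z.2 = p z.1}] (y₀, t)) := by
    refine tendsto_nhdsWithin_iff.2 ⟨?_, hright t ht⟩
    rw [nhds_prod_eq]
    exact tendsto_id.prodMk (hcont t ht)
  have h3 := h1.tendsto.comp h2
  rw [hsymm t ht]
  exact h3

/-- The coefficient `(f, g)` of the left regular representation with respect to counting measures
on the fibres of the range map. -/
noncomputable def discreteCoeff (𝒢 : TopGroupoid G X) (f g : C_c(G, ℂ)) : G → ℂ :=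
  fun x => ∑' t : {t // 𝒢.r t = 𝒢.r x}, ⟪f (𝒢.mul (𝒢.inv x) t), g t⟫_ℂ

theorem continuous_discreteCoeff [T2Space G] [T2Space X] (hG : 𝒢.IsRDiscrete)
    (hr : IsLocalHomeomorph 𝒢.r) (f g : C_c(G, ℂ)) : Continuous (𝒢.discreteCoeff f g) := by
  refine continuous_tsum_fiber hG hr 𝒢.continuous_r g.hasCompactSupport
    (h := fun x t => ⟪f (𝒢.mul (𝒢.inv x) t), g t⟫_ℂ) (fun x t hne => ?_) ?_
  · refine subset_tsupport _ fun h0 => hne ?_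
    rw [h0, inner_zero_right]
  · have h1 := f.continuous.comp_continuousOn 𝒢.continuousOn_inv_mul
    exact h1.inner (𝕜 := ℂ) (g.continuous.comp continuous_snd).continuousOn

theorem exists_tsum_norm_sq_le [T2Space G] [T2Space X] (hG : 𝒢.IsRDiscrete)
    (hr : IsLocalHomeomorph 𝒢.r) (f : C_c(G, ℂ)) :
    ∃ C : ℝ, 0 < C ∧ ∀ a, ∑' t : {t // 𝒢.r t = a}, ‖f t‖ ^ 2 ≤ C ^ 2 := by
  have hc : Continuous fun a => ∑' t : {t // 𝒢.r t = a}, ‖f t‖ ^ 2 :=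
    continuous_tsum_fiber hG hr continuous_id f.hasCompactSupport
      (h := fun _ t => ‖f t‖ ^ 2) (fun a t hne => subset_tsupport _ fun h0 => hne (by simp [h0]))
      (by fun_prop)
  obtain ⟨C, hC⟩ := (f.hasCompactSupport.isCompact.image 𝒢.continuous_r).exists_bound_of_continuousOn
    hc.continuousOn
  refine ⟨max C 1, by positivity, fun a => ?_⟩
  -- Taking the constant at least `1` lets its square bound the sum, so it can serve as a bound for
  -- the `ℓ²` norm.
  have h1 : max C 1 ≤ max C 1 ^ 2 := by nlinarith [le_max_right C 1]
  by_cases ha : a ∈ 𝒢.r '' tsupport f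
  · exact ((le_abs_self _).trans (hC a ha)).trans ((le_max_left _ _).trans h1)
  · rw [tsum_fiber_eq_sum (h := fun t => ‖f t‖ ^ 2) ∅ (by simp), Finset.sum_empty]
    · positivity
    · intro t ht hne
      exact (ha ⟨t, subset_tsupport _ fun h0 => hne (by simp [h0]), ht⟩).elim

section Haar

variable [T2Space G] [LocallyCompactSpace G] [SecondCountableTopology G] [MeasurableSpace G]
  [BorelSpace G] {lam : X → Measure G}

/-- The mass of `{t}` depends only on `s t`, so it is a factor independent of `x` and passes into
`g`. Since it is continuous and nonzero, the passage can be made in both directions. -/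
theorem IsHaarSystem.regularCoeff_eq (hlam : 𝒢.IsHaarSystem lam) (hG : 𝒢.IsRDiscrete)
    (f : C_c(G, ℂ)) {g g' : C_c(G, ℂ)}
    (hg : ∀ t, g' t = ((lam (𝒢.s t)).real {𝒢.unit (𝒢.s t)} : ℂ) * g t) :
    𝒢.regularCoeff lam f g = 𝒢.discreteCoeff f g' := by
  have := 𝒢.t2Space_units
  funext x
  have hfin := hG.finite_inter_fiber g.hasCompactSupport.isCompact (𝒢.r x)
  have hT : ∀ t ∈ hfin.toFinset, 𝒢.r t = 𝒢.r x := fun t ht => (hfin.mem_toFinset.1 ht).2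
  have hT' : ∀ t, 𝒢.r t = 𝒢.r x → g t ≠ 0 → t ∈ hfin.toFinset := fun t ht hne =>
    hfin.mem_toFinset.2 ⟨subset_tsupport _ hne, ht⟩
  unfold regularCoeff discreteCoeff
  rw [hlam.integral_eq_sum hfin.toFinset,
    tsum_fiber_eq_sum (h := fun t => ⟪f (𝒢.mul (𝒢.inv x) t), g' t⟫_ℂ) hfin.toFinset hT]
  · refine Finset.sum_congr rfl fun t ht => ?_
    rw [hg, ← hlam.measureReal_singleton hG t, hT t ht, ← smul_eq_mul, inner_smul_right,
      Complex.real_smul]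
  · intro t ht hne
    refine hT' t ht fun h0 => hne ?_
    simp [hg, h0]
  · intro t ht hne
    refine hT' t ht fun h0 => hne ?_
    simp [h0]

theorem IsHaarSystem.exists_discreteCoeff_eq (hlam : 𝒢.IsHaarSystem lam) (hG : 𝒢.IsRDiscrete)
    (f g : C_c(G, ℂ)) : ∃ g', 𝒢.regularCoeff lam f g = 𝒢.discreteCoeff f g' :=
  ⟨(⟨_, (hlam.continuous_measureReal_unit hG).comp 𝒢.continuous_s⟩ : C(G, ℂ)) • g,
    hlam.regularCoeff_eq hG f fun _ => rfl⟩

theorem IsHaarSystem.discreteCoeff_mem (hlam : 𝒢.IsHaarSystem lam) (hG : 𝒢.IsRDiscrete)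
    (f g : C_c(G, ℂ)) : 𝒢.discreteCoeff f g ∈ 𝒢.regularAlgebra lam := by
  have hne : ∀ t, ((lam (𝒢.s t)).real {𝒢.unit (𝒢.s t)} : ℂ) ≠ 0 := fun t => by
    rw [← hlam.measureReal_singleton hG t]
    exact_mod_cast (hlam.measureReal_singleton_pos hG t).ne'
  refine NonUnitalAlgebra.subset_adjoin ℂ ⟨f,
    (⟨_, ((hlam.continuous_measureReal_unit hG).comp 𝒢.continuous_s).inv₀ hne⟩ : C(G, ℂ)) • g,
    (hlam.regularCoeff_eq hG f fun t => ?_).symm⟩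
  exact (mul_inv_cancel_left₀ (hne t) (g t)).symm

end Haar

end TopGroupoid

end RDiscrete

/-! ### Square summable families with values in a Hilbert space -/

section SquareSummable

/-- A bijection of index sets and a unitary of the coefficient spaces induce a unitary between
spaces of square summable families. -/
noncomputable def lpCongr {ι κ E F : Type*} [NormedAddCommGroup E] [InnerProductSpace ℂ E]
    [NormedAddCommGroup F] [InnerProductSpace ℂ F] (e : κ ≃ ι) (L : E ≃ₗᵢ[ℂ] F) :
    lp (fun _ : ι => E) 2 ≃ₗᵢ[ℂ] lp (fun _ : κ => F) 2 where
  toFun f := ⟨fun k => L (f (e k)), by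
    have h := (memℓp_gen_iff (by norm_num)).1 (lp.memℓp f)
    refine memℓp_gen ?_
    simpa [Function.comp_def] using (e.summable_iff (f := fun i => ‖f i‖ ^ (2 : ENNReal).toReal)).2 h⟩
  map_add' f g := by ext k; exact map_add L _ _
  map_smul' c f := by ext k; simp
  invFun f := ⟨fun i => L.symm (f (e.symm i)), by
    have h := (memℓp_gen_iff (by norm_num)).1 (lp.memℓp f)
    refine memℓp_gen ?_
    simpa [Function.comp_def] using (e.symm.summable_iff (f := fun i => ‖f i‖ ^ (2 : ENNReal).toReal)).2 h⟩
  left_inv f := by ext i; simp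
  right_inv f := by ext k; simp
  norm_map' f := by
    rw [lp.norm_eq_tsum_rpow (by norm_num), lp.norm_eq_tsum_rpow (by norm_num)]
    congr 1
    simpa using e.tsum_eq (fun i => ‖f i‖ ^ (2 : ENNReal).toReal)

theorem lpCongr_apply {ι κ E F : Type*} [NormedAddCommGroup E] [InnerProductSpace ℂ E]
    [NormedAddCommGroup F] [InnerProductSpace ℂ F] (e : κ ≃ ι) (L : E ≃ₗᵢ[ℂ] F)
    (f : lp (fun _ : ι => E) 2) (k : κ) : lpCongr e L f k = L (f (e k)) := rfl

theorem lp_mem_of_single_mem {ι E : Type*} [DecidableEq ι] [NormedAddCommGroup E]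
    [InnerProductSpace ℂ E] {T : Submodule ℂ (lp (fun _ : ι => E) 2)}
    (hT : IsClosed (T : Set (lp (fun _ : ι => E) 2)))
    (h : ∀ (i : ι) (v : E), lp.single 2 i v ∈ T) (f : lp (fun _ : ι => E) 2) : f ∈ T :=
  hT.mem_of_tendsto (lp.hasSum_single (by norm_num) f)
    (Eventually.of_forall fun _ => T.sum_mem fun i _ => h i (f i))

theorem separableSpace_lp {ι E : Type*} [Countable ι] [NormedAddCommGroup E]
    [InnerProductSpace ℂ E] [TopologicalSpace.SeparableSpace E] :
    TopologicalSpace.SeparableSpace (lp (fun _ : ι => E) 2) := by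
  classical
  rw [← TopologicalSpace.isSeparable_univ_iff]
  have h : TopologicalSpace.IsSeparable
      (⋃ i : ι, range (lp.single (E := fun _ : ι => E) 2 i)) :=
    TopologicalSpace.IsSeparable.iUnion fun i =>
      TopologicalSpace.isSeparable_range (lp.isometry_single (E := fun _ : ι => E) i).continuous
  refine (h.span (R := ℂ)).closure.mono fun f _ => ?_
  refine lp_mem_of_single_mem (T := (Submodule.span ℂ _).topologicalClosure)
    (Submodule.isClosed_topologicalClosure _) (fun i v => ?_) f
  exact Submodule.le_topologicalClosure _ (Submodule.subset_span (mem_iUnion.2 ⟨i, v, rfl⟩))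

theorem lp_norm_le_of_le {ι E : Type*} [NormedAddCommGroup E] (v : lp (fun _ : ι => E) 2)
    {w : ι → ℝ} (hw : Summable fun i => w i ^ 2) {c C : ℝ} (hc : 0 ≤ c) (hC : 0 ≤ C)
    (hv : ∀ i, ‖v i‖ ≤ c * w i) (hwC : ∑' i, w i ^ 2 ≤ C ^ 2) : ‖v‖ ≤ c * C := by
  refine lp.norm_le_of_tsum_le (by norm_num) (mul_nonneg hc hC) ?_
  have h2 : (2 : ENNReal).toReal = (2 : ℕ) := by norm_num
  simp only [h2, Real.rpow_natCast]
  have hle : ∀ i, ‖v i‖ ^ 2 ≤ c ^ 2 * w i ^ 2 := fun i => by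
    rw [← mul_pow]
    exact pow_le_pow_left₀ (norm_nonneg _) (hv i) 2
  calc ∑' i, ‖v i‖ ^ 2 ≤ ∑' i, c ^ 2 * w i ^ 2 :=
        ((hw.mul_left _).of_nonneg_of_le (fun i => by positivity) hle).tsum_le_tsum hle
          (hw.mul_left _)
    _ = c ^ 2 * ∑' i, w i ^ 2 := tsum_mul_left
    _ ≤ (c * C) ^ 2 := by
      rw [mul_pow]
      exact mul_le_mul_of_nonneg_left hwC (sq_nonneg c)

end SquareSummable

/-! ### The induced bundle and Fell absorption -/

section Induced

variable {G X : Type u} [TopologicalSpace G] [TopologicalSpace X]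

namespace TopGroupoid

/-- Left translation by `x⁻¹`, from the fibre of the range map at `r x` to that at `s x`. -/
def fiberEquiv (𝒢 : TopGroupoid G X) (x : G) {a b : X} (ha : 𝒢.s x = a) (hb : 𝒢.r x = b) :
    {t // 𝒢.r t = b} ≃ {t // 𝒢.r t = a} where
  toFun t := ⟨𝒢.mul (𝒢.inv x) t, (𝒢.r_inv_mul (t.2.trans hb.symm)).trans ha⟩
  invFun t := ⟨𝒢.mul x t, (𝒢.r_mul x t (ha.trans t.2.symm)).trans hb⟩
  left_inv t := Subtype.ext (𝒢.mul_inv_cancel_left' (t.2.trans hb.symm))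
  right_inv t := Subtype.ext (𝒢.inv_mul_cancel_left' (t.2.trans ha.symm))

theorem fiberEquiv_mul (𝒢 : TopGroupoid G X) (x y : G) {a b c : X} (hya : 𝒢.s y = a)
    (hyb : 𝒢.r y = b) (hxb : 𝒢.s x = b) (hxc : 𝒢.r x = c) (hsa : 𝒢.s (𝒢.mul x y) = a)
    (hrc : 𝒢.r (𝒢.mul x y) = c) (t : {t // 𝒢.r t = c}) :
    𝒢.fiberEquiv (𝒢.mul x y) hsa hrc t =
      𝒢.fiberEquiv y hya hyb (𝒢.fiberEquiv x hxb hxc t) := by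
  -- For the inverse maps the identity is just associativity `(xy)z = x(yz)`, so no formula for
  -- `(xy)⁻¹` is needed.
  rw [← Equiv.eq_symm_apply]
  conv_lhs => rw [← (𝒢.fiberEquiv x hxb hxc).symm_apply_apply t,
    ← (𝒢.fiberEquiv y hya hyb).symm_apply_apply (𝒢.fiberEquiv x hxb hxc t)]
  generalize 𝒢.fiberEquiv y hya hyb (𝒢.fiberEquiv x hxb hxc t) = z
  refine Subtype.ext (𝒢.mul_assoc x y z (hxb.trans hyb.symm) (hya.trans z.2.symm)).symm

variable {𝒢 : TopGroupoid G X} [T2Space X]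

/-- The family `t ↦ f t • v t`, for `f ∈ C_c(G)`, in the `ℓ²`-space of a fibre of the range map. -/
noncomputable def IsRDiscrete.compactFamily (hG : 𝒢.IsRDiscrete) (f : C_c(G, ℂ)) {a : X}
    {E : Type*} [NormedAddCommGroup E] [InnerProductSpace ℂ E] (v : {t // 𝒢.r t = a} → E) :
    lp (fun _ : {t // 𝒢.r t = a} => E) 2 :=
  ⟨fun t => f t • v t, by
    refine (memℓp_zero (((hG.finite_inter_fiber f.hasCompactSupport.isCompact a).preimage
      Subtype.val_injective.injOn).subset fun t ht => ?_)).of_exponent_ge zero_le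
    exact ⟨subset_tsupport _ fun h0 => ht (by simp [h0]), t.2⟩⟩

theorem IsRDiscrete.compactFamily_apply (hG : 𝒢.IsRDiscrete) (f : C_c(G, ℂ)) {a : X}
    {E : Type*} [NormedAddCommGroup E] [InnerProductSpace ℂ E] (v : {t // 𝒢.r t = a} → E)
    (t : {t // 𝒢.r t = a}) : hG.compactFamily f v t = f t • v t := rfl

theorem IsRDiscrete.summable_norm_sq (hG : 𝒢.IsRDiscrete) (f : C_c(G, ℂ)) (a : X) :
    Summable fun t : {t // 𝒢.r t = a} => ‖f t‖ ^ 2 := by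
  refine summable_of_hasFiniteSupport (((hG.finite_inter_fiber f.hasCompactSupport.isCompact
    a).preimage Subtype.val_injective.injOn).subset fun t ht => ?_)
  exact ⟨subset_tsupport _ fun h0 => ht (by simp [h0]), t.2⟩

end TopGroupoid

open TopGroupoid

namespace GHilbertBundle

variable {𝒢 : TopGroupoid G X} (H : GHilbertBundle 𝒢)

theorem act_section_congr {z t : G} (h : z = t) {a b : X} (ha : 𝒢.s z = a) (hb : 𝒢.r z = b)
    (hb' : 𝒢.r t = b) (ζ : ∀ a, H.fiber a) : H.act z ha hb (ζ a) = H.act t rfl hb' (ζ (𝒢.s t)) := by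
  subst h; subst ha; rfl

theorem act_act_inv_mul {x t : G} (h : 𝒢.r t = 𝒢.r x) (ζ : ∀ a, H.fiber a) :
    H.act x rfl rfl (H.act (𝒢.mul (𝒢.inv x) t) rfl (𝒢.r_inv_mul h)
      (ζ (𝒢.s (𝒢.mul (𝒢.inv x) t)))) = H.act t rfl h (ζ (𝒢.s t)) := by
  have hm := 𝒢.mul_inv_cancel_left' h
  rw [← H.act_mul x (𝒢.mul (𝒢.inv x) t) rfl (𝒢.r_inv_mul h) rfl rfl
    (by rw [hm, 𝒢.s_inv_mul h]) (by rw [hm, h])]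
  exact H.act_section_congr hm _ _ h ζ

/-- The action of `G` on the bundle with fibres `ℓ²(r⁻¹{a}) ⊗ H_a`. -/
noncomputable def inducedAct (x : G) {a b : X} (ha : 𝒢.s x = a) (hb : 𝒢.r x = b) :
    lp (fun _ : {t // 𝒢.r t = a} => H.fiber a) 2 ≃ₗᵢ[ℂ]
      lp (fun _ : {t // 𝒢.r t = b} => H.fiber b) 2 :=
  lpCongr (𝒢.fiberEquiv x ha hb) (H.act x ha hb)

theorem inducedAct_mul (x y : G) {a b c : X} (hya : 𝒢.s y = a) (hyb : 𝒢.r y = b)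
    (hxb : 𝒢.s x = b) (hxc : 𝒢.r x = c) (hsa : 𝒢.s (𝒢.mul x y) = a)
    (hrc : 𝒢.r (𝒢.mul x y) = c) (v : lp (fun _ : {t // 𝒢.r t = a} => H.fiber a) 2) :
    H.inducedAct (𝒢.mul x y) hsa hrc v = H.inducedAct x hxb hxc (H.inducedAct y hya hyb v) := by
  ext t
  unfold inducedAct
  rw [lpCongr_apply, lpCongr_apply, lpCongr_apply, fiberEquiv_mul 𝒢 x y hya hyb hxb hxc,
    H.act_mul x y hya hyb hxb hxc]

/-- The squared norm expands into `‖ξ‖² ∘ r`, `‖ζ‖² ∘ s` and the real part of the coefficient `(ζ,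
ξ)`. -/
theorem continuous_norm_sub_act {ξ ζ : ∀ a, H.fiber a} (hξ : ξ ∈ H.boundedSections)
    (hζ : ζ ∈ H.boundedSections) :
    Continuous fun y => ‖ξ (𝒢.r y) - H.act y rfl rfl (ζ (𝒢.s y))‖ := by
  have h1 := (H.continuous_norm ξ hξ.1).comp 𝒢.continuous_r
  have h2 := (H.continuous_norm ζ hζ.1).comp 𝒢.continuous_s
  have h3 := Complex.continuous_re.comp (H.continuous_coeff ζ hζ ξ hξ)
  have h4 := (((h1.pow 2).sub (h3.const_mul 2)).add (h2.pow 2)).sqrt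
  refine h4.congr fun y => ?_
  rw [← Real.sqrt_sq (norm_nonneg (ξ (𝒢.r y) - H.act y rfl rfl (ζ (𝒢.s y)))),
    norm_sub_sq (𝕜 := ℂ), LinearIsometryEquiv.norm_map, inner_re_symm]
  rfl

variable [T2Space X] (hG : 𝒢.IsRDiscrete)

/-- The section of the induced bundle whose value at `t` is `f t • L_t ζ(s t)`. -/
noncomputable def translatedSection (f : C_c(G, ℂ)) (ζ : ∀ a, H.fiber a) (a : X) :
    lp (fun _ : {t // 𝒢.r t = a} => H.fiber a) 2 :=
  hG.compactFamily f fun t => H.act t rfl t.2 (ζ (𝒢.s t))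

/-- The sections `t ↦ f t • L_t ζ(s t)`, for `f ∈ C_c(G)` and `ζ` a bounded continuous section. -/
def translatedSections : Set (∀ a, lp (fun _ : {t // 𝒢.r t = a} => H.fiber a) 2) :=
  {σ | ∃ f : C_c(G, ℂ), ∃ ζ ∈ H.boundedSections, σ = H.translatedSection hG f ζ}

/-- The section of the induced bundle whose value at `t` is `f t • ξ(r t)`. -/
noncomputable def rangeSection (f : C_c(G, ℂ)) (ξ : ∀ a, H.fiber a) (a : X) :
    lp (fun _ : {t // 𝒢.r t = a} => H.fiber a) 2 :=
  hG.compactFamily f fun _ => ξ a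

/-- Since `L_x L_{x⁻¹t} = L_t`, the action only moves the scalar `f`. The isometry `L_t` then
cancels, and the remaining factor `⟨ζ, ζ'⟩ ∘ s` goes into `g`. -/
theorem inner_inducedAct_translatedSection (f g : C_c(G, ℂ)) {ζ ζ' : ∀ a, H.fiber a}
    (hζ : ζ ∈ H.sections) (hζ' : ζ' ∈ H.sections) :
    (fun x => ⟪H.inducedAct x rfl rfl (H.translatedSection hG f ζ (𝒢.s x)),
      H.translatedSection hG g ζ' (𝒢.r x)⟫_ℂ) =
    𝒢.discreteCoeff f ((⟨_, (H.continuous_inner hζ hζ').comp 𝒢.continuous_s⟩ : C(G, ℂ)) • g) := by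
  funext x
  rw [lp.inner_eq_tsum]
  refine tsum_congr fun t => ?_
  unfold inducedAct translatedSection
  rw [lpCongr_apply, hG.compactFamily_apply, hG.compactFamily_apply, map_smul]
  have h := H.act_act_inv_mul (x := x) t.2 ζ
  change ⟪f (𝒢.mul (𝒢.inv x) t) • H.act x rfl rfl (H.act (𝒢.mul (𝒢.inv x) t) rfl
    (𝒢.r_inv_mul t.2) (ζ (𝒢.s (𝒢.mul (𝒢.inv x) t)))), _⟫_ℂ =
    ⟪f (𝒢.mul (𝒢.inv x) t), ⟪ζ (𝒢.s t), ζ' (𝒢.s t)⟫_ℂ • g t⟫_ℂ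
  rw [h, inner_smul_left, inner_smul_right, inner_smul_right, LinearIsometryEquiv.inner_map_map,
    RCLike.inner_apply]
  ring

/-- Here the vectors do not depend on `t` within a fibre, so their inner product comes out of the
sum. -/
theorem inner_inducedAct_rangeSection (f g : C_c(G, ℂ)) (ξ η : ∀ a, H.fiber a) :
    (fun x => ⟪H.inducedAct x rfl rfl (H.rangeSection hG f ξ (𝒢.s x)),
      H.rangeSection hG g η (𝒢.r x)⟫_ℂ) = coeff H ξ η * 𝒢.discreteCoeff f g := by
  funext x
  rw [lp.inner_eq_tsum, Pi.mul_apply, discreteCoeff, ← tsum_mul_left]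
  refine tsum_congr fun t => ?_
  unfold inducedAct rangeSection
  rw [lpCongr_apply, hG.compactFamily_apply, hG.compactFamily_apply, map_smul, inner_smul_left,
    inner_smul_right, RCLike.inner_apply]
  simp only [coeff, fiberEquiv, Equiv.coe_fn_mk]
  ring

/-- If `f` is a bump function at `t` whose support meets the fibre only in `t`, the section takes
the value `L_t ζ(s t)` placed at `t`. These vectors are dense in that summand because `L_t` is onto.
-/
theorem dense_span_translatedSections [T2Space G] [LocallyCompactSpace G] (a : X) :
    Dense (Submodule.span ℂ {v | ∃ σ ∈ H.translatedSections hG, σ a = v} :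
      Set (lp (fun _ : {t // 𝒢.r t = a} => H.fiber a) 2)) := by
  classical
  let T := (Submodule.span ℂ {v | ∃ σ ∈ H.translatedSections hG, σ a = v}).topologicalClosure
  have hT : IsClosed (T : Set (lp (fun _ : {t // 𝒢.r t = a} => H.fiber a) 2)) :=
    Submodule.isClosed_topologicalClosure _
  refine fun v => lp_mem_of_single_mem hT ?_ v
  intro t w
  obtain ⟨U, hU, htU, hinj⟩ := hG.exists_injOn_r (t : G)
  obtain ⟨f, hf1, hf2⟩ := exists_compactlySupported_eq_one hU htU
  have hc : Continuous fun z : H.fiber (𝒢.s t) =>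
      lp.single (E := fun _ : {t // 𝒢.r t = a} => H.fiber a) 2 t (H.act t rfl t.2 z) :=
    (lp.isometry_single (E := fun _ : {t // 𝒢.r t = a} => H.fiber a) t).continuous.comp
      (LinearIsometryEquiv.continuous _)
  have hall : ∀ z : H.fiber (𝒢.s t),
      lp.single (E := fun _ : {t // 𝒢.r t = a} => H.fiber a) 2 t (H.act t rfl t.2 z) ∈ T := by
    intro z
    refine (H.dense_boundedSections (𝒢.s t)).induction
      (P := fun z => lp.single (E := fun _ : {t // 𝒢.r t = a} => H.fiber a) 2 t
        (H.act t rfl t.2 z) ∈ T) ?_ (hT.preimage hc) z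
    rintro _ ⟨ζ, hζ, rfl⟩
    refine Submodule.le_topologicalClosure _ (Submodule.subset_span ⟨_, ⟨f, ζ, hζ, rfl⟩, ?_⟩)
    ext t'
    unfold translatedSection
    rw [hG.compactFamily_apply]
    by_cases htt : t' = t
    · subst htt
      rw [lp.single_apply_self, hf1.self_of_nhds, one_smul]
    · rw [lp.single_apply_ne _ _ _ htt]
      have : f t' = 0 := by
        by_contra hne
        exact htt (Subtype.ext (hinj (hf2 _ hne) htU (t'.2.trans t.2.symm)))
      rw [this, zero_smul]
  have := hall ((H.act t rfl t.2).symm w)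
  rwa [LinearIsometryEquiv.apply_symm_apply] at this

/-- Choose `ζ` with `ζ(s y)` close to `L_y⁻¹ ξ(r y)`; by continuity `L_z ζ(s z)` stays close to `ξ(r
z)` for `z` near `y`. A partition of unity on the support of `f` glues these choices. The bound `C`
on the fibrewise `ℓ²` norms of `f` turns the pointwise error `ε / C` into `ε`. -/
theorem exists_translatedSection_approx [T2Space G] [LocallyCompactSpace G]
    (hr : IsLocalHomeomorph 𝒢.r) (f : C_c(G, ℂ)) {ξ : ∀ a, H.fiber a}
    (hξ : ξ ∈ H.boundedSections) {ε : ℝ} (hε : 0 < ε) :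
    ∃ σ ∈ Submodule.span ℂ (H.translatedSections hG),
      ∀ a, ‖H.rangeSection hG f ξ a - σ a‖ ≤ ε := by
  obtain ⟨C, hC, hfC⟩ := exists_tsum_norm_sq_le hG hr f
  have hδ : 0 < ε / C := div_pos hε hC
  have hex : ∀ y : G, ∃ ζ ∈ H.boundedSections,
      ‖ξ (𝒢.r y) - H.act y rfl rfl (ζ (𝒢.s y))‖ < ε / C := by
    intro y
    obtain ⟨_, ⟨ζ, hζ, rfl⟩, hd⟩ := (H.dense_boundedSections (𝒢.s y)).exists_dist_lt
      ((H.act y rfl rfl).symm (ξ (𝒢.r y))) hδ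
    refine ⟨ζ, hζ, ?_⟩
    rwa [← (H.act y rfl rfl).dist_map, LinearIsometryEquiv.apply_symm_apply, dist_eq_norm] at hd
  choose ζ hζ hlt using hex
  let U : G → Set G := fun y =>
    {z | ‖ξ (𝒢.r z) - H.act z rfl rfl (ζ y (𝒢.s z))‖ < ε / C}
  have hU : ∀ y, IsOpen (U y) := fun y =>
    isOpen_lt (H.continuous_norm_sub_act hξ (hζ y)) continuous_const
  obtain ⟨F, hF, hcov⟩ := f.hasCompactSupport.isCompact.elim_nhds_subcover U
    fun y _ => (hU y).mem_nhds (hlt y)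
  let y : Fin F.card → G := fun i => (F.equivFin.symm i : G)
  have hcov' : tsupport f ⊆ ⋃ i, U (y i) := by
    refine hcov.trans (iUnion₂_subset fun z hz => ?_)
    refine subset_iUnion_of_subset (F.equivFin ⟨z, hz⟩) ?_
    simp [y]
  obtain ⟨ρ, hρU, hρ1, hρ01, _⟩ := exists_continuous_sum_one_of_isOpen_isCompact
    (fun i => hU (y i)) f.hasCompactSupport.isCompact hcov'
  let fρ : Fin F.card → C_c(G, ℂ) := fun i =>
    (⟨fun z => (ρ i z : ℂ), Complex.continuous_ofReal.comp (ρ i).continuous⟩ : C(G, ℂ)) • f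
  refine ⟨∑ i, H.translatedSection hG (fρ i) (ζ (y i)), Submodule.sum_mem _ fun i _ =>
    Submodule.subset_span ⟨_, _, hζ _, rfl⟩, fun a => ?_⟩
  have hεC : ε = ε / C * C := by field_simp
  rw [hεC]
  refine lp_norm_le_of_le _ (w := fun t : {t // 𝒢.r t = a} => ‖f t‖) (hG.summable_norm_sq f a) hδ.le hC.le ?_ (hfC a)
  rintro ⟨t, rfl⟩
  have hval : (H.rangeSection hG f ξ (𝒢.r t) -
      (∑ i, H.translatedSection hG (fρ i) (ζ (y i))) (𝒢.r t)) ⟨t, rfl⟩ =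
      f t • ξ (𝒢.r t) - ∑ i, ((ρ i t : ℂ) * f t) • H.act t rfl rfl (ζ (y i) (𝒢.s t)) := by
    rw [Finset.sum_apply, lp.coeFn_sub, Pi.sub_apply, lp.coeFn_sum, Finset.sum_apply]
    rfl
  rw [hval]
  by_cases hft : f t = 0
  · simp [hft]
  · have hsum : ∑ i, ρ i t = 1 := by
      have := hρ1 (subset_tsupport _ hft)
      simpa using this
    have hsumC : ∑ i, (ρ i t : ℂ) = 1 := by exact_mod_cast hsum
    have : f t • ξ (𝒢.r t) - ∑ i, ((ρ i t : ℂ) * f t) • H.act t rfl rfl (ζ (y i) (𝒢.s t)) =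
        ∑ i, (f t * (ρ i t : ℂ)) • (ξ (𝒢.r t) - H.act t rfl rfl (ζ (y i) (𝒢.s t))) := by
      simp_rw [smul_sub]
      rw [Finset.sum_sub_distrib, ← Finset.sum_smul, ← Finset.mul_sum, hsumC, mul_one]
      simp_rw [mul_comm]
    rw [this]
    calc _ ≤ ∑ i, ‖(f t * (ρ i t : ℂ)) • (ξ (𝒢.r t) - H.act t rfl rfl (ζ (y i) (𝒢.s t)))‖ :=
          norm_sum_le _ _
      _ ≤ ∑ i, ‖f t‖ * (ε / C) * ρ i t := by
          refine Finset.sum_le_sum fun i _ => ?_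
          rw [norm_smul, norm_mul, Complex.norm_real, Real.norm_of_nonneg (hρ01 i t).1,
            _root_.mul_assoc, _root_.mul_assoc]
          refine mul_le_mul_of_nonneg_left ?_ (norm_nonneg _)
          rw [mul_comm]
          by_cases h0 : ρ i t = 0
          · simp [h0]
          · exact mul_le_mul_of_nonneg_right (hρU i (subset_tsupport _ h0)).le (hρ01 i t).1
      _ = ε / C * ‖f t‖ := by
          rw [← Finset.mul_sum, hsum, mul_one, mul_comm]

theorem exists_norm_rangeSection_le [T2Space G] (hr : IsLocalHomeomorph 𝒢.r) (f : C_c(G, ℂ))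
    {ξ : ∀ a, H.fiber a} (hξ : ξ ∈ H.boundedSections) :
    ∃ P : ℝ, 0 < P ∧ ∀ a, ‖H.rangeSection hG f ξ a‖ ≤ P := by
  obtain ⟨C, hC, hfC⟩ := exists_tsum_norm_sq_le hG hr f
  obtain ⟨D, hD, hξD⟩ := HilbertBundle.exists_bound_of_mem hξ
  refine ⟨D * C, mul_pos hD hC, fun a =>
    lp_norm_le_of_le _ (w := fun t : {t // 𝒢.r t = a} => ‖f t‖) (hG.summable_norm_sq f a) hD.le hC.le
      (fun t => ?_) (hfC a)⟩
  change ‖f t • ξ a‖ ≤ _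
  rw [norm_smul, mul_comm]
  exact mul_le_mul_of_nonneg_right (hξD a) (norm_nonneg _)

end GHilbertBundle

end Induced

/-! ### The ideal property of `A(G)` -/

section Ideal

variable {G X : Type u} [TopologicalSpace G] [TopologicalSpace X] [MeasurableSpace G]
  {𝒢 : TopGroupoid G X} {lam : X → Measure G}

open TopGroupoid

theorem mem_fourierAlgebra_iff {φ : G → ℂ} :
    φ ∈ 𝒢.fourierAlgebra lam ↔ φ ∈ 𝒢.fourierStieltjes ∧
      ∀ θ : ℝ, 0 < θ → ∃ ψ ∈ 𝒢.regularAlgebra lam, HasCoeffBound 𝒢 (φ - ψ) θ θ := by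
  refine and_congr_right fun _ => ⟨fun h θ hθ => ?_, fun h ε hε => ?_⟩
  · obtain ⟨ψ, hψ, hmem, hlt⟩ := h (θ ^ 2) (by positivity)
    exact ⟨ψ, hψ, hasCoeffBound_of_fsNorm_lt hmem hθ hlt⟩
  · obtain ⟨ψ, hψ, hb⟩ := h (Real.sqrt (ε / 2)) (by positivity)
    refine ⟨ψ, hψ, hb.mem, (hb.fsNorm_le (by positivity) (by positivity)).trans_lt ?_⟩
    rw [Real.mul_self_sqrt (by positivity)]
    exact half_lt_self hε

theorem add_mem_fourierAlgebra {φ φ' : G → ℂ} (h : φ ∈ 𝒢.fourierAlgebra lam)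
    (h' : φ' ∈ 𝒢.fourierAlgebra lam) : φ + φ' ∈ 𝒢.fourierAlgebra lam := by
  rw [mem_fourierAlgebra_iff] at *
  refine ⟨(fourierStieltjesSubalgebra 𝒢).add_mem h.1 h'.1, fun θ hθ => ?_⟩
  obtain ⟨ψ, hψ, hb⟩ := h.2 (θ / 2) (half_pos hθ)
  obtain ⟨ψ', hψ', hb'⟩ := h'.2 (θ / 2) (half_pos hθ)
  refine ⟨ψ + ψ', add_mem hψ hψ', ?_⟩
  have := hb.add hb' (half_pos hθ).le (half_pos hθ).le (half_pos hθ).le (half_pos hθ).le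
  rwa [add_halves, ← add_sub_add_comm] at this

theorem zero_mem_fourierAlgebra : (0 : G → ℂ) ∈ 𝒢.fourierAlgebra lam := by
  rw [mem_fourierAlgebra_iff]
  refine ⟨(fourierStieltjesSubalgebra 𝒢).zero_mem, fun θ hθ => ⟨0, zero_mem _, ?_⟩⟩
  have := (hasCoeffBound_one 𝒢).const_smul 0
  rw [zero_smul, norm_zero, zero_mul] at this
  rw [sub_zero]
  exact this.balance zero_le_one le_rfl hθ (by rw [mul_zero]; positivity)

/-- The Fourier algebra contains the limits of its members. -/
theorem mem_fourierAlgebra_of_approx {φ : G → ℂ} (h : φ ∈ 𝒢.fourierStieltjes)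
    (happ : ∀ θ : ℝ, 0 < θ → ∃ ψ ∈ 𝒢.fourierAlgebra lam, HasCoeffBound 𝒢 (φ - ψ) θ θ) :
    φ ∈ 𝒢.fourierAlgebra lam := by
  refine mem_fourierAlgebra_iff.2 ⟨h, fun θ hθ => ?_⟩
  obtain ⟨ψ, hψ, hb⟩ := happ (θ / 2) (half_pos hθ)
  obtain ⟨χ, hχ, hb'⟩ := (mem_fourierAlgebra_iff.1 hψ).2 (θ / 2) (half_pos hθ)
  refine ⟨χ, hχ, ?_⟩
  have := hb.add hb' (half_pos hθ).le (half_pos hθ).le (half_pos hθ).le (half_pos hθ).le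
  rwa [add_halves, sub_add_sub_cancel] at this

theorem mul_approx {φ : G → ℂ} (h : φ ∈ 𝒢.fourierAlgebra lam) {β : G → ℂ}
    (hβ : β ∈ 𝒢.fourierStieltjes) {θ : ℝ} (hθ : 0 < θ) :
    ∃ ψ ∈ 𝒢.regularAlgebra lam, HasCoeffBound 𝒢 (β * φ - β * ψ) θ θ := by
  obtain ⟨C, hC, hb⟩ := exists_hasCoeffBound_of_mem hβ
  obtain ⟨ψ, hψ, hb'⟩ := (mem_fourierAlgebra_iff.1 h).2 (θ / C) (by positivity)
  refine ⟨ψ, hψ, ?_⟩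
  have := hb.mul hb' hC.le hC.le
  rwa [mul_div_cancel₀ _ hC.ne', mul_sub] at this

variable [T2Space G] [LocallyCompactSpace G] [SecondCountableTopology G] [BorelSpace G]

/-- The product of a coefficient of a `G`-Hilbert bundle with a coefficient of the left regular
representation lies in the Fourier algebra. -/
theorem coeff_mul_discreteCoeff_mem (hlam : 𝒢.IsHaarSystem lam) (hG : 𝒢.IsRDiscrete)
    (H : GHilbertBundle 𝒢) {ξ η : ∀ a, H.fiber a} (hξ : ξ ∈ H.boundedSections)
    (hη : η ∈ H.boundedSections) (f g : C_c(G, ℂ)) :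
    coeff H ξ η * 𝒢.discreteCoeff f g ∈ 𝒢.fourierAlgebra lam := by
  have := 𝒢.t2Space_units
  have hr := hlam.isLocalHomeomorph_r hG
  have := fun a => hG.countable_fiber a
  have : ∀ a, TopologicalSpace.SeparableSpace (lp (fun _ : {t // 𝒢.r t = a} => H.fiber a) 2) :=
    fun a => separableSpace_lp
  set S := H.translatedSections hG with hS
  -- Coefficients of combinations of translated sections lie in `A_c(G)` itself; these will be the
  -- approximants.
  have hspan : ∀ σ ∈ Submodule.span ℂ S, ∀ τ ∈ Submodule.span ℂ S,
      (fun x => ⟪H.inducedAct x rfl rfl (σ (𝒢.s x)), τ (𝒢.r x)⟫_ℂ) ∈ 𝒢.regularAlgebra lam := by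
    intro σ hσ τ hτ
    induction hσ, hτ using Submodule.span_induction₂ with
    | mem_mem σ τ hσ hτ =>
      obtain ⟨f, ζ, hζ, rfl⟩ := hσ
      obtain ⟨g, ζ', hζ', rfl⟩ := hτ
      rw [H.inner_inducedAct_translatedSection hG f g hζ.1 hζ'.1]
      exact hlam.discreteCoeff_mem hG _ _
    | zero_left =>
      simp only [Pi.zero_apply, map_zero, inner_zero_left]
      exact zero_mem (𝒢.regularAlgebra lam)
    | zero_right =>
      simp only [Pi.zero_apply, inner_zero_right]
      exact zero_mem (𝒢.regularAlgebra lam)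
    | add_left σ σ' τ _ _ _ h1 h2 =>
      simp only [Pi.add_apply, map_add, inner_add_left]
      exact add_mem h1 h2
    | add_right σ τ τ' _ _ _ h1 h2 =>
      simp only [Pi.add_apply, inner_add_right]
      exact add_mem h1 h2
    | smul_left c σ τ _ _ h =>
      simp only [Pi.smul_apply, map_smul, inner_smul_left]
      exact SMulMemClass.smul_mem (starRingEnd ℂ c) h
    | smul_right c σ τ _ _ h =>
      simp only [Pi.smul_apply, inner_smul_right]
      exact SMulMemClass.smul_mem c h
  have hbound : ∀ σ ∈ locallyApproximable (Submodule.span ℂ S),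
      ∀ τ ∈ locallyApproximable (Submodule.span ℂ S), ∀ p q : ℝ, (∀ a, ‖σ a‖ ≤ p) →
      (∀ a, ‖τ a‖ ≤ q) →
      HasCoeffBound 𝒢 (fun x => ⟪H.inducedAct x rfl rfl (σ (𝒢.s x)), τ (𝒢.r x)⟫_ℂ) p q := by
    intro σ hσ τ hτ p q hp hq
    refine hasCoeffBound_of_generators (fun x _ _ ha hb => H.inducedAct x ha hb)
      (fun x y _ _ _ hya hyb hxb hxc hsa hrc v =>
        H.inducedAct_mul x y hya hyb hxb hxc hsa hrc v)
      S (H.dense_span_translatedSections hG) ?_ hσ hτ hp hq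
    rintro _ ⟨f, ζ, hζ, rfl⟩ _ ⟨g, ζ', hζ', rfl⟩
    rw [H.inner_inducedAct_translatedSection hG f g hζ.1 hζ'.1]
    exact continuous_discreteCoeff hG hr _ _
  have hmem : ∀ (f : C_c(G, ℂ)) {ξ : ∀ a, H.fiber a}, ξ ∈ H.boundedSections →
      H.rangeSection hG f ξ ∈ locallyApproximable (Submodule.span ℂ S) := by
    intro f ξ hξ a ε hε
    obtain ⟨σ, hσ, h⟩ := H.exists_translatedSection_approx hG hr f hξ hε
    exact ⟨σ, hσ, Eventually.of_forall h⟩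
  have hle := le_locallyApproximable (Submodule.span ℂ S)
  obtain ⟨P, hP, hfP⟩ := H.exists_norm_rangeSection_le hG hr f hξ
  obtain ⟨Q, hQ, hgQ⟩ := H.exists_norm_rangeSection_le hG hr g hη
  rw [← H.inner_inducedAct_rangeSection hG f g ξ η]
  refine mem_fourierAlgebra_iff.2
    ⟨(hbound _ (hmem f hξ) _ (hmem g hη) P Q hfP hgQ).mem, fun θ hθ => ?_⟩
  -- With `F`, `K` the range sections of `f`, `g`, the difference is `(F, K) - (σ, τ) = (F - σ, K) +
  -- (σ, K - τ)`. The error for `τ` is measured against the bound `P'` of `σ`, so `σ` comes first;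
  -- each term then has product bound `(θ / 2) ^ 2 / 2`.
  obtain ⟨σ, hσ, hfσ⟩ := H.exists_translatedSection_approx hG hr f hξ
    (ε := (θ / 2) ^ 2 / (2 * Q)) (by positivity)
  have hσP : ∀ a, ‖σ a‖ ≤ P + (θ / 2) ^ 2 / (2 * Q) := fun a => by
    have := norm_sub_norm_le (σ a) (H.rangeSection hG f ξ a)
    rw [norm_sub_rev] at this
    linarith [hfσ a, hfP a]
  set P' := P + (θ / 2) ^ 2 / (2 * Q) with hP'
  have hP'pos : 0 < P' := by positivity
  obtain ⟨τ, hτ, hgτ⟩ := H.exists_translatedSection_approx hG hr g hη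
    (ε := (θ / 2) ^ 2 / (2 * P')) (by positivity)
  refine ⟨_, hspan σ hσ τ hτ, ?_⟩
  have hθ2 : 0 < (θ / 2) ^ 2 := by positivity
  have b1 := (hbound _ (sub_mem (hmem f hξ) (hle hσ)) _ (hmem g hη) _ Q hfσ hgQ).balance
    (by positivity) hQ.le (half_pos hθ) (by
      have : (θ / 2) ^ 2 / (2 * Q) * Q = (θ / 2) ^ 2 / 2 := by field_simp
      linarith)
  have b2 := (hbound _ (hle hσ) _ (sub_mem (hmem g hη) (hle hτ)) P' _ hσP hgτ).balance
    hP'pos.le (by positivity) (half_pos hθ) (by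
      have : P' * ((θ / 2) ^ 2 / (2 * P')) = (θ / 2) ^ 2 / 2 := by field_simp
      linarith)
  have b3 := b1.add b2 (half_pos hθ).le (half_pos hθ).le (half_pos hθ).le (half_pos hθ).le
  rw [add_halves] at b3
  convert b3 using 1
  funext x
  simp only [Pi.sub_apply, Pi.add_apply, map_sub, inner_sub_left, inner_sub_right]
  ring

theorem discreteCoeff_mem_fourierAlgebra (hlam : 𝒢.IsHaarSystem lam) (hG : 𝒢.IsRDiscrete)
    {β : G → ℂ} (hβ : β ∈ 𝒢.fourierStieltjes) (f g : C_c(G, ℂ)) :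
    β * 𝒢.discreteCoeff f g ∈ 𝒢.fourierAlgebra lam := by
  obtain ⟨H, ξ, hξ, η, hη, rfl⟩ := hβ
  exact coeff_mul_discreteCoeff_mem hlam hG H hξ hη f g

theorem mul_regularCoeff_mem (hlam : 𝒢.IsHaarSystem lam) (hG : 𝒢.IsRDiscrete)
    {β : G → ℂ} (hβ : β ∈ 𝒢.fourierStieltjes) (f g : C_c(G, ℂ)) :
    β * 𝒢.regularCoeff lam f g ∈ 𝒢.fourierAlgebra lam := by
  obtain ⟨g', hg'⟩ := hlam.exists_discreteCoeff_eq hG f g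
  rw [hg']
  exact discreteCoeff_mem_fourierAlgebra hlam hG hβ f g'

/-- The absorption argument with `β = 1` already places the regular coefficients in `B(G)`. -/
theorem regularAlgebra_le (hlam : 𝒢.IsHaarSystem lam) (hG : 𝒢.IsRDiscrete) :
    𝒢.regularAlgebra lam ≤ (fourierStieltjesSubalgebra 𝒢).toNonUnitalSubalgebra := by
  refine NonUnitalAlgebra.adjoin_le ?_
  rintro _ ⟨f, g, rfl⟩
  have := (mul_regularCoeff_mem hlam hG (hasCoeffBound_one 𝒢).mem f g).1
  rwa [one_mul] at this

theorem regularAlgebra_subset_fourierAlgebra (hlam : 𝒢.IsHaarSystem lam) (hG : 𝒢.IsRDiscrete)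
    {ψ : G → ℂ} (hψ : ψ ∈ 𝒢.regularAlgebra lam) : ψ ∈ 𝒢.fourierAlgebra lam := by
  refine mem_fourierAlgebra_iff.2 ⟨regularAlgebra_le hlam hG hψ, fun θ hθ => ⟨ψ, hψ, ?_⟩⟩
  -- A small representation of `0 = ψ - ψ` is obtained by adding a small coefficient to its
  -- negative.
  obtain ⟨χ, hχ, h⟩ := (mem_fourierAlgebra_iff.1 (zero_mem_fourierAlgebra (𝒢 := 𝒢)
    (lam := lam))).2 (θ / 2) (half_pos hθ)
  have h2 := h.const_smul (-1)
  have := h.add h2 (half_pos hθ).le (half_pos hθ).le (half_pos hθ).le (by positivity)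
  rw [norm_neg, norm_one, one_mul, add_halves] at this
  convert this using 1
  simp

theorem mul_regularAlgebra_mem (hlam : 𝒢.IsHaarSystem lam) (hG : 𝒢.IsRDiscrete)
    {ψ : G → ℂ} (hψ : ψ ∈ 𝒢.regularAlgebra lam) :
    ∀ β ∈ 𝒢.fourierStieltjes, β * ψ ∈ 𝒢.fourierAlgebra lam := by
  unfold regularAlgebra at hψ
  induction hψ using NonUnitalAlgebra.adjoin_induction with
  | mem ψ h =>
    obtain ⟨f, g, rfl⟩ := h
    exact fun β hβ => mul_regularCoeff_mem hlam hG hβ f g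
  | add ψ χ _ _ h1 h2 =>
    intro β hβ
    rw [mul_add]
    exact add_mem_fourierAlgebra (h1 β hβ) (h2 β hβ)
  | zero =>
    intro β _
    rw [mul_zero]
    exact zero_mem_fourierAlgebra
  | smul c ψ _ h =>
    intro β hβ
    rw [mul_smul_comm, ← smul_mul_assoc]
    exact h _ ((fourierStieltjesSubalgebra 𝒢).smul_mem hβ c)
  | mul ψ χ hψ hχ h1 _ =>
    intro β hβ
    have hχB : χ ∈ 𝒢.fourierStieltjes := regularAlgebra_le hlam hG hχ
    -- Write the product as `χ (β ψ)`. Approximating `β ψ` by `κ` in `A_c(G)` gives approximants `χ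
    -- κ`, again in `A_c(G)`.
    rw [← _root_.mul_assoc, mul_comm]
    refine mem_fourierAlgebra_of_approx
      ((fourierStieltjesSubalgebra 𝒢).mul_mem hχB (h1 β hβ).1) fun θ hθ => ?_
    obtain ⟨κ, hκ, hb⟩ := mul_approx (h1 β hβ) hχB hθ
    exact ⟨χ * κ, regularAlgebra_subset_fourierAlgebra hlam hG (mul_mem hχ hκ), hb⟩

theorem mul_mem_fourierAlgebra (hlam : 𝒢.IsHaarSystem lam) (hG : 𝒢.IsRDiscrete) {β φ : G → ℂ}
    (hβ : β ∈ 𝒢.fourierStieltjes) (hφ : φ ∈ 𝒢.fourierAlgebra lam) :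
    β * φ ∈ 𝒢.fourierAlgebra lam := by
  refine mem_fourierAlgebra_of_approx
    ((fourierStieltjesSubalgebra 𝒢).mul_mem hβ hφ.1) fun θ hθ => ?_
  obtain ⟨ψ, hψ, hb⟩ := mul_approx hφ hβ hθ
  exact ⟨β * ψ, mul_regularAlgebra_mem hlam hG hψ β hβ, hb⟩

end Ideal

theorem corollary3 {G X : Type u} [TopologicalSpace G] [T2Space G] [LocallyCompactSpace G]
    [SecondCountableTopology G] [MeasurableSpace G] [BorelSpace G] [TopologicalSpace X]
    (𝒢 : TopGroupoid G X) (lam : X → Measure G) (hlam : 𝒢.IsHaarSystem lam)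
    (hG : 𝒢.IsRDiscrete) :
    ∃ B : Subalgebra ℂ (G → ℂ), (B : Set (G → ℂ)) = 𝒢.fourierStieltjes ∧
      ∃ I : Ideal B, Subtype.val '' (I : Set B) = 𝒢.fourierAlgebra lam := by
  refine ⟨fourierStieltjesSubalgebra 𝒢, rfl,
    { carrier := {φ | (φ : G → ℂ) ∈ 𝒢.fourierAlgebra lam}
      add_mem' := fun h h' => add_mem_fourierAlgebra h h'
      zero_mem' := zero_mem_fourierAlgebra
      smul_mem' := fun β _ h => mul_mem_fourierAlgebra hlam hG β.2 h }, ?_⟩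
  ext φ
  constructor
  · rintro ⟨φ, h, rfl⟩
    exact h
  · exact fun h => ⟨⟨φ, h.1⟩, h, rfl⟩
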